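/- Theorem. A \emph{voter} over a finite candidate set $C$ is \emph{irrational with ties} if, for every unordered pair $\{a,b\}$ of distinct candidates, it states exactly one of $a>b$, $b>a$, $a\sim b$ (transitivity is not required), and \emph{irrational without ties} if moreover it never states $a\sim b$. Given a collection of voters with positive integral weights, $a$ defeats $b$ if the total weight of the voters with $a>b$ exceeds that of the voters with $b>a$, and $a$ and $b$ tie if the two are equal. The Llull (Copeland$^1$) score of $a$ is the number of candidates $b\neq a$ that $a$ defeats or ties. A candidate $p$ is a winner in the nonunique-winner model if no candidate has a larger score than $p$, and in the unique-winner model if every other candidate has a smaller score than $p$. Llull-CWCM (constructive coalitional weighted manipulation) is the following decision problem. Given: a candidate set $C$ (of any size), a collection $V$ of nonmanipulative voters with positive integral weights and given votes, a preferred candidate $p\in C$, and a collection $W$ of manipulators with given positive integral weights. Question: can the votes of the manipulators be set such that $p$ is a Llull winner of the election $(C,V\cup W)$? The weights are written in binary, and the number of candidates is not bounded. Then Llull-CWCM is in $\mathrm{P}$ for irrational voters with ties (all voters and manipulators may have ties) and for irrational voters without ties (none may), each in the nonunique-winner model and in the unique-winner model. -/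

import Mathlib

/-! ### Polynomial-time decidability -/

/-- The decision problem `Q`, whose instances are written as words through `encode`, is in P:
some (multi-stack) Turing machine, given the word of an instance `x`, outputs the truth value of
`Q x` within a number of steps that is polynomial in the length of that word. -/
def InP {α Γ : Type} [Fintype Γ] (encode : α → List Γ) (Q : α → Prop) : Prop :=
  ∃ f : α → Bool, (∀ x, f x = true ↔ Q x) ∧
    Nonempty (Turing.TM2ComputableInPolyTime encode Computability.encodeBool f)

namespace Election

/-! ### Votes and elections -/

/-- An irrational vote, possibly with ties, over the candidates `0, …, m - 1`: for every unordered
pair of distinct candidates exactly one of `a > b`, `b > a`, `a ∼ b` holds (the last one if neither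
of the first two does). No transitivity is required. -/
@[ext] structure PairwiseVote (m : ℕ) where
  /-- `prefers a b = true` means `a > b` -/
  prefers : Fin m → Fin m → Bool
  asymm : ∀ a b, prefers a b = true → prefers b a = false

/-- Whether ties are allowed in the votes. -/
inductive TieModel
  | withTies
  | withoutTies

/-- The votes that may be cast (by manipulators and nonmanipulators alike) in each of the two
models. -/
def PairwiseVote.IsAllowed {m : ℕ} (v : PairwiseVote m) : TieModel → Prop
  | .withTies => True
  | .withoutTies => ∀ a b, a ≠ b → v.prefers a b = true ∨ v.prefers b a = true

/-- A collection of voters, each with a positive integral weight and a vote. -/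
abbrev Profile (m : ℕ) : Type := List (ℕ+ × PairwiseVote m)

/-- The total weight of the voters that prefer `a` to `b`. -/
def support {m : ℕ} (V : Profile m) (a b : Fin m) : ℕ :=
  (V.map fun v => if v.2.prefers a b = true then (v.1 : ℕ) else 0).sum

/-- The Copeland^α score: one point for every pairwise majority election that `a` wins, and `α`
points for every one that is tied. -/
def copelandScore (α : ℚ) {m : ℕ} (V : Profile m) (a : Fin m) : ℚ :=
  ∑ b ∈ Finset.univ.erase a,
    if support V b a < support V a b then 1
    else if support V a b = support V b a then α
    else 0

/-- The nonunique-winner and the unique-winner model. -/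
inductive WinnerModel
  | nonunique
  | unique

/-- `p` is a Llull (that is, Copeland^1) winner. -/
def IsLlullWinner {m : ℕ} (V : Profile m) (p : Fin m) : WinnerModel → Prop
  | .nonunique => ∀ a, copelandScore 1 V a ≤ copelandScore 1 V p
  | .unique => ∀ a, a ≠ p → copelandScore 1 V a < copelandScore 1 V p

/-! ### Constructive coalitional weighted manipulation -/

/-- An instance of CWCM for irrational voters: the candidates are `0, …, numCandidates - 1`, and of
the manipulators only the weights are given. -/
@[ext] structure CWCMInstance (t : TieModel) where
  numCandidates : ℕ
  voters : Profile numCandidates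
  voters_allowed : ∀ v ∈ voters, v.2.IsAllowed t
  preferred : Fin numCandidates
  manipulators : List ℕ+

/-- The question of Llull-CWCM: the votes of the manipulators can be set such that the preferred
candidate wins the election in which all voters and all manipulators take part. -/
def LlullCWCM (t : TieModel) (w : WinnerModel) (I : CWCMInstance t) : Prop :=
  ∃ W : Profile I.numCandidates,
    W.map Prod.fst = I.manipulators ∧ (∀ v ∈ W, v.2.IsAllowed t) ∧
      IsLlullWinner (I.voters ++ W) I.preferred w

/-! ### Instances as words over Mathlib's Turing machine alphabet -/

open Computability (Γ')

/-- A word of bits. -/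
def encodeBits (l : List Bool) : List Γ' := l.map Γ'.bit

/-- A weight in binary, least significant bit first. -/
def encodeWeight (n : ℕ+) : List Γ' := encodeBits (Nat.bits n)

/-- A vote, as its preference matrix: one row of bits for each candidate, each row ended by a
comma. -/
def encodeVote {m : ℕ} (v : PairwiseVote m) : List Γ' :=
  (List.finRange m).flatMap fun a =>
    encodeBits ((List.finRange m).map fun b => v.prefers a b) ++ [Γ'.comma]

/-- A voter: the weight and the vote, in brackets. -/
def encodeVoter {m : ℕ} (v : ℕ+ × PairwiseVote m) : List Γ' :=
  Γ'.bra :: (encodeWeight v.1 ++ Γ'.comma :: (encodeVote v.2 ++ [Γ'.ket]))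

/-- An instance: one bit for each candidate, which marks the preferred one; then the voters; then
the weights of the manipulators, each ended by a comma. -/
def encodeCWCM {t : TieModel} (I : CWCMInstance t) : List Γ' :=
  encodeBits ((List.finRange I.numCandidates).map fun a => decide (a = I.preferred)) ++
    Γ'.comma :: (I.voters.flatMap encodeVoter ++
      Γ'.comma :: I.manipulators.flatMap fun n => encodeWeight n ++ [Γ'.comma])

/-! ### Different instances are written differently -/

theorem encodeBits_append_inj {l l' : List Bool} {s s' : Γ'} {r r' : List Γ'}
    (hs : ∀ b, s ≠ Γ'.bit b) (hs' : ∀ b, s' ≠ Γ'.bit b)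
    (h : encodeBits l ++ s :: r = encodeBits l' ++ s' :: r') : l = l' ∧ s = s' ∧ r = r' := by
  induction l generalizing l' with
  | nil =>
    cases l' with
    | nil => simpa [encodeBits] using h
    | cons b l' => simp [encodeBits, hs b] at h
  | cons b l ih =>
    cases l' with
    | nil => simp [encodeBits, (hs' b).symm] at h
    | cons b' l' =>
      simp only [encodeBits, List.map_cons, List.cons_append, List.cons.injEq, Γ'.bit.injEq] at h
      obtain ⟨rfl, h2⟩ := h
      obtain ⟨rfl, h3⟩ := ih h2
      exact ⟨rfl, h3⟩

theorem encodeWeight_append_inj {n n' : ℕ+} {s s' : Γ'} {r r' : List Γ'}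
    (hs : ∀ b, s ≠ Γ'.bit b) (hs' : ∀ b, s' ≠ Γ'.bit b)
    (h : encodeWeight n ++ s :: r = encodeWeight n' ++ s' :: r') : n = n' ∧ s = s' ∧ r = r' := by
  obtain ⟨h1, h2⟩ := encodeBits_append_inj hs hs' h
  refine ⟨?_, h2⟩
  have h3 := congrArg (fun l : List Bool => l.foldr Nat.bit 0) h1
  have key : ∀ k : ℕ, (Nat.bits k).foldr Nat.bit 0 = k := by
    intro k
    induction k using Nat.binaryRec' with
    | zero => simp
    | bit b k hb ih => rw [Nat.bits_append_bit _ _ hb]; simp [ih]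
  simp only [key] at h3
  exact PNat.coe_injective h3

theorem encodeRows_append_inj {m : ℕ} (rows : List (Fin m)) (f g : Fin m → List Bool)
    {r r' : List Γ'}
    (h : (rows.flatMap fun a => encodeBits (f a) ++ [Γ'.comma]) ++ r =
      (rows.flatMap fun a => encodeBits (g a) ++ [Γ'.comma]) ++ r') :
    (∀ a ∈ rows, f a = g a) ∧ r = r' := by
  induction rows with
  | nil => simpa using h
  | cons a rows ih =>
    simp only [List.flatMap_cons, List.append_assoc, List.cons_append, List.nil_append] at h
    obtain ⟨h1, -, h2⟩ := encodeBits_append_inj (by simp) (by simp) h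
    obtain ⟨h3, h4⟩ := ih h2
    exact ⟨by simpa using ⟨h1, h3⟩, h4⟩

theorem encodeVote_append_inj {m : ℕ} {v v' : PairwiseVote m} {r r' : List Γ'}
    (h : encodeVote v ++ r = encodeVote v' ++ r') : v = v' ∧ r = r' := by
  obtain ⟨h1, h2⟩ := encodeRows_append_inj _ _ _ h
  refine ⟨?_, h2⟩
  ext a b
  have h3 := h1 a (List.mem_finRange a)
  rw [List.map_inj_left.1 h3 b (List.mem_finRange b)]

theorem encodeVoters_append_inj {m : ℕ} {V V' : Profile m} {r r' : List Γ'}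
    (h : V.flatMap encodeVoter ++ Γ'.comma :: r = V'.flatMap encodeVoter ++ Γ'.comma :: r') :
    V = V' ∧ r = r' := by
  induction V generalizing V' with
  | nil => cases V' <;> simp_all [encodeVoter]
  | cons v V ih =>
    cases V' with
    | nil => simp [encodeVoter] at h
    | cons v' V' =>
      simp only [List.flatMap_cons, encodeVoter, List.append_assoc, List.cons_append,
        List.nil_append, List.cons.injEq, true_and] at h
      obtain ⟨h1, -, h2⟩ := encodeWeight_append_inj (by simp) (by simp) h
      obtain ⟨h3, h4⟩ := encodeVote_append_inj h2
      obtain ⟨h5, h6⟩ := ih (List.cons.inj h4).2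
      exact ⟨by rw [Prod.ext h1 h3, h5], h6⟩

theorem encodeWeights_inj {L L' : List ℕ+}
    (h : (L.flatMap fun n => encodeWeight n ++ [Γ'.comma]) =
      L'.flatMap fun n => encodeWeight n ++ [Γ'.comma]) : L = L' := by
  induction L generalizing L' with
  | nil => cases L' <;> simp_all
  | cons n L ih =>
    cases L' with
    | nil => simp at h
    | cons n' L' =>
      simp only [List.flatMap_cons, List.append_assoc, List.cons_append, List.nil_append] at h
      obtain ⟨rfl, -, h2⟩ := encodeWeight_append_inj (by simp) (by simp) h
      rw [ih h2]

theorem encodeCWCM_injective (t : TieModel) :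
    Function.Injective (encodeCWCM : CWCMInstance t → List Γ') := by
  rintro ⟨m, V, hV, p, W⟩ ⟨m', V', hV', p', W'⟩ h
  obtain ⟨h1, -, h2⟩ := encodeBits_append_inj (by simp) (by simp) h
  obtain rfl : m = m' := by simpa using congrArg List.length h1
  obtain ⟨rfl, h3⟩ := encodeVoters_append_inj h2
  obtain rfl := encodeWeights_inj h3
  have h4 := List.map_inj_left.1 h1 p (List.mem_finRange p)
  obtain rfl : p = p' := by simpa using h4
  rfl

end Election

/-! It costs nothing to let every manipulator prefer `p` to all others, and this fixes the score
`bestScore` of `p`. A pair of other candidates is either free, meaning that the united coalition can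
make either side defeat the other, or some side has a point that the coalition cannot take away (a
forced point). Forced points also arise against `p` itself. A tie gives a Llull point to both sides,
so the coalition loses nothing by voting unanimously and without ties; this is why both tie models
have the same answer. What remains is to hand each free pair to one of its ends such that no
candidate other than `p` gets more than `d` = `scoreBound` points, forced ones included. By Hall's
theorem (`exists_orientation`) this is possible as soon as no set `r` is overloaded, that is, the
free pairs inside `r` plus the forced points of `r` number at most `#r * d`.

Overload is detected by a balancing process instead of a flow computation. In every round each free
pair gives two points to the end that has fewer so far, or one to each end if they are level, and
each forced point counts two. If a solution exists, the greedy choice does at least as well as the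
solution against weights that increase with the points (`sum_mul_gain_le`). Hence the sum of the
squared excesses over `2 * d` per round grows by at most `4 * n ^ 3` a round (`sum_sq_points_le`),
and after `k` rounds every excess is below `t` whenever `4 * k * n ^ 3 < t ^ 2` (`points_lt`).
Conversely, by integrality an overloaded set receives at least one point too many in every round,
however the pairs are decided, so excesses below `t` with `n * t ≤ k` rule it out
(`card_free_add_le`). The choice `k = (n + 4) ^ 6`, `t = (n + 4) ^ 5` meets both conditions and
yields the criterion `llullCWCM_iff`.

This criterion is evaluated by a function that is shown to be polynomial-time by closure properties.
A small structured language of stack programs compiles to Turing machines with the same step count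
up to one final step. On top of it, `PTime` is closed under composition, pairing, case distinction,
and iteration with polynomially bounded intermediate values (`PTime.iterate_len`). Parsing, binary
addition and comparison, and the balancing rounds are built from these. -/

/-! ### Stack programs: semantics, compilation to Turing machines, and running times. -/

section

open Function Computability

/-! ### A structured language for stack machines -/

namespace StackProgram

/-- Programs over stacks that are numbered by `ℕ` and hold symbols of the alphabet `Γ'`. -/
inductive Cmd : Type
  | skip
  | push (r : ℕ) (x : Γ')
  | seq (c d : Cmd)
  | popCase (r : ℕ) (c : Cmd) (d : Γ' → Cmd)
  | popWhile (r : ℕ) (d : Γ' → Cmd)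

infixr:60 " ;; " => Cmd.seq

/-- The contents of all stacks, the top being the head of the list. -/
abbrev Store := ℕ → List Γ'

/-- `Exec c s s' t`: started with the stacks `s`, the program `c` ends with the stacks `s'` after
`t` steps. -/
inductive Exec : Cmd → Store → Store → ℕ → Prop
  | skip (s) : Exec .skip s s 1
  | push (r x s) : Exec (.push r x) s (update s r (x :: s r)) 1
  | seq {c d s s' s'' t t'} (h : Exec c s s' t) (h' : Exec d s' s'' t') :
      Exec (.seq c d) s s'' (t + t' + 1)
  | popCase_nil {r c d s s' t} (hr : s r = []) (h : Exec c s s' t) :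
      Exec (.popCase r c d) s s' (t + 1)
  | popCase_cons {r c d s s' t x l} (hr : s r = x :: l)
      (h : Exec (d x) (update s r l) s' t) : Exec (.popCase r c d) s s' (t + 1)
  | popWhile_nil {r d s} (hr : s r = []) : Exec (.popWhile r d) s s 1
  | popWhile_cons {r d s s' s'' t t' x l} (hr : s r = x :: l)
      (h : Exec (d x) (update s r l) s' t) (h' : Exec (.popWhile r d) s' s'' t') :
      Exec (.popWhile r d) s s'' (t + t' + 1)

/-- A step pushes at most one symbol. Through this, a time bound is also a bound on the size of the
output. -/
theorem Exec.length_le {c s s' t} (h : Exec c s s' t) (r : ℕ) :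
    (s' r).length ≤ (s r).length + t := by
  induction h with
  | skip s => omega
  | push r' x s => by_cases h : r = r' <;> simp [h]
  | seq h h' ih ih' => omega
  | popCase_nil hr h ih => omega
  | @popCase_cons r' c d s s' t x l hr h ih =>
    by_cases h : r = r'
    · subst h; simp [hr] at ih ⊢; omega
    · simp [h] at ih ⊢; omega
  | popWhile_nil hr => omega
  | @popWhile_cons r' c s s' s'' t t' x l hr h h' ih ih' =>
    by_cases h : r = r'
    · subst h; simp [hr] at ih ⊢; omega
    · simp [h] at ih ⊢; omega

/-- All stacks that the program mentions have numbers at most `m`. -/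
def Cmd.StacksLE (m : ℕ) : Cmd → Prop
  | .skip => True
  | .push r _ => r ≤ m
  | .seq c d => c.StacksLE m ∧ d.StacksLE m
  | .popCase r c d => r ≤ m ∧ c.StacksLE m ∧ ∀ x, (d x).StacksLE m
  | .popWhile r d => r ≤ m ∧ ∀ x, (d x).StacksLE m

theorem Cmd.StacksLE.mono {m m' : ℕ} (hm : m ≤ m') {c : Cmd} (h : c.StacksLE m) :
    c.StacksLE m' := by
  induction c with
  | skip => trivial
  | push r x => exact le_trans h hm
  | seq c d ih ih' => exact ⟨ih h.1, ih' h.2⟩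
  | popCase r c d ih ih' => exact ⟨h.1.trans hm, ih h.2.1, fun x => ih' x (h.2.2 x)⟩
  | popWhile r d ih => exact ⟨h.1.trans hm, fun x => ih x (h.2 x)⟩

/-- A machine has finitely many stacks. The alphabet is finite, so even the branching commands
mention only finitely many. -/
theorem Cmd.exists_stacksLE (c : Cmd) : ∃ m, c.StacksLE m := by
  induction c with
  | skip => exact ⟨0, trivial⟩
  | push r x => exact ⟨r, le_rfl⟩
  | seq c d ih ih' =>
    obtain ⟨m, h⟩ := ih
    obtain ⟨m', h'⟩ := ih'
    exact ⟨max m m', h.mono (le_max_left _ _), h'.mono (le_max_right _ _)⟩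
  | popCase r c d ih ih' =>
    obtain ⟨m, h⟩ := ih
    choose f hf using ih'
    have hle : ∀ x, f x ≤ Finset.univ.sup f := fun x => Finset.le_sup (Finset.mem_univ x)
    exact ⟨r + m + Finset.univ.sup f, by omega, h.mono (by omega),
      fun x => (hf x).mono (by have := hle x; omega)⟩
  | popWhile r d ih =>
    choose f hf using ih
    have hle : ∀ x, f x ≤ Finset.univ.sup f := fun x => Finset.le_sup (Finset.mem_univ x)
    exact ⟨r + Finset.univ.sup f, by omega, fun x => (hf x).mono (by have := hle x; omega)⟩

/-! ### Compilation to Turing machines -/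

/-- The continuations that occur when `c` is run with the continuation `k`. -/
def continuations : Cmd → List Cmd → Set (List Cmd)
  | .skip, k => {.skip :: k}
  | .push r x, k => {.push r x :: k}
  | .seq c d, k => {(.seq c d) :: k} ∪ continuations c (d :: k) ∪ continuations d k
  | .popCase r c d, k =>
      {.popCase r c d :: k} ∪ continuations c k ∪ ⋃ x, continuations (d x) k
  | .popWhile r d, k =>
      {.popWhile r d :: k} ∪ ⋃ x, continuations (d x) (.popWhile r d :: k)

/-- Continuations serve as the control states of the machine, so they must be finite in number. A
loop causes no growth, because its body always returns to the same continuation, the loop followed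
by `k`. -/
theorem finite_continuations (c : Cmd) (k : List Cmd) : (continuations c k).Finite := by
  induction c generalizing k with
  | skip => exact Set.finite_singleton _
  | push r x => exact Set.finite_singleton _
  | seq c d ih ih' => exact ((Set.finite_singleton _).union (ih _)).union (ih' _)
  | popCase r c d ih ih' =>
    exact ((Set.finite_singleton _).union (ih _)).union (Set.finite_iUnion fun x => ih' x _)
  | popWhile r d ih => exact (Set.finite_singleton _).union (Set.finite_iUnion fun x => ih x _)

theorem self_mem_continuations (c : Cmd) (k : List Cmd) : c :: k ∈ continuations c k := by
  cases c <;> simp [continuations]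

/-- The labels of the machine of `c`. -/
abbrev Label (c : Cmd) : Type := ↥(insert [] (continuations c []))

noncomputable instance (c : Cmd) : Fintype (Label c) :=
  ((finite_continuations c []).insert []).fintype

open Classical in
/-- The label of a continuation. -/
noncomputable def toLabel (c : Cmd) (k : List Cmd) : Label c :=
  if h : k ∈ insert [] (continuations c []) then ⟨k, h⟩ else ⟨[], Set.mem_insert _ _⟩

theorem toLabel_val {c : Cmd} {k : List Cmd} (h : k ∈ insert [] (continuations c [])) :
    (toLabel c k).1 = k := by
  rw [toLabel, dif_pos h]

/-- The alphabets of the stacks: `none` is the output stack. -/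
@[reducible] def Alphabet (m : ℕ) : Option (Fin (m + 1)) → Type
  | none => Bool
  | some _ => Γ'

/-- The number `r` as the name of a stack of the machine. -/
@[reducible] def stack (m r : ℕ) : Option (Fin (m + 1)) := some (Fin.ofNat (m + 1) r)

/-- The statement of the machine for a continuation. At the end, the top of stack `0` is the
answer. -/
noncomputable def statement (c : Cmd) (m : ℕ) :
    List Cmd → Turing.TM2.Stmt (Alphabet m) (Label c) (Option Γ')
  | [] => .pop (stack m 0) (fun _ x => x) <| .push none (fun v => decide (v = some (.bit true))) <|
      .load (fun _ => none) .halt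
  | .skip :: k => .goto fun _ => toLabel c k
  | .push r x :: k => .push (stack m r) (fun _ => x) <| .goto fun _ => toLabel c k
  | .seq d e :: k => .goto fun _ => toLabel c (d :: e :: k)
  | .popCase r d e :: k => .pop (stack m r) (fun _ x => x) <| .goto fun v =>
      v.elim (toLabel c (d :: k)) fun x => toLabel c (e x :: k)
  | .popWhile r d :: k => .pop (stack m r) (fun _ x => x) <| .goto fun v =>
      v.elim (toLabel c k) fun x => toLabel c (d x :: .popWhile r d :: k)

/-- The machine of a program. -/
noncomputable def machine (c : Cmd) (m : ℕ) : Turing.FinTM2 where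
  K := Option (Fin (m + 1))
  k₀ := stack m 0
  k₁ := none
  Γ := Alphabet m
  Λ := Label c
  main := toLabel c [c]
  σ := Option Γ'
  initialState := none
  Γk₀Fin := inferInstanceAs (Fintype Γ')
  m l := statement c m l.1

/-- The stacks of the machine. -/
def toStacks (m : ℕ) (s : Store) : (k : Option (Fin (m + 1))) → List (Alphabet m k)
  | none => []
  | some i => s i

theorem update_toStacks {m r : ℕ} (hr : r ≤ m) (s : Store) (l : List Γ') :
    update (toStacks m s) (stack m r) l = toStacks m (update s r l) := by
  have hr' : ((Fin.ofNat (m + 1) r : Fin (m + 1)) : ℕ) = r := by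
    simp [Nat.mod_eq_of_lt (Nat.lt_succ_of_le hr)]
  funext k
  cases k with
  | none => simp [toStacks]
  | some i =>
    by_cases h : i = Fin.ofNat (m + 1) r
    · subst h
      simp only [update_self, toStacks]
      rw [hr', update_self]
    · have h' : (i : ℕ) ≠ r := fun h' => h (Fin.ext (h'.trans hr'.symm))
      rw [update_of_ne (by simpa using h)]
      simp only [toStacks]
      rw [update_of_ne h']

theorem toStacks_stack {m r : ℕ} (hr : r ≤ m) (s : Store) : toStacks m s (stack m r) = s r := by
  simp [toStacks, Nat.mod_eq_of_lt (Nat.lt_succ_of_le hr)]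

/-- Iteration of the steps of the machine. -/
def Steps (c : Cmd) (m : ℕ) (k k' : List Cmd) (v v' : Option Γ') (s s' : Store) (t : ℕ) : Prop :=
  (flip bind (Turing.TM2.step fun l : Label c => statement c m l.1))^[t]
    (some ⟨some (toLabel c k), v, toStacks m s⟩) = some ⟨some (toLabel c k'), v', toStacks m s'⟩

theorem Steps.trans {c m k k' k'' v v' v'' s s' s'' t t'} (h : Steps c m k k' v v' s s' t)
    (h' : Steps c m k' k'' v' v'' s' s'' t') : Steps c m k k'' v v'' s s'' (t + t') := by
  unfold Steps at *
  rw [add_comm t t', Function.iterate_add_apply, h, h']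

/-- Each step of the semantics is one step of the machine. The inclusion of continuations guarantees
that every label met is genuine and not the default value of `toLabel`. The final register value is
existential because it depends on the last symbol popped. -/
theorem Exec.steps {c₀ : Cmd} {m : ℕ} {c s s' t} (h : Exec c s s' t) :
    ∀ (k : List Cmd) (v : Option Γ'), c.StacksLE m →
      continuations c k ⊆ insert [] (continuations c₀ []) →
      ∃ v', Steps c₀ m (c :: k) k v v' s s' t := by
  induction h with
  | skip s =>
    intro k v hm hk
    have h1 := toLabel_val (hk (self_mem_continuations _ _))
    refine ⟨v, ?_⟩
    simp [Steps, flip, h1, statement]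
  | push r x s =>
    intro k v hm hk
    have h1 := toLabel_val (hk (self_mem_continuations _ _))
    refine ⟨v, ?_⟩
    simp [Steps, flip, h1, statement, toStacks_stack hm, ← update_toStacks hm]
  | @seq c d s s' s'' t t' h h' ih ih' =>
    intro k v hm hk
    have h1 := toLabel_val (hk (self_mem_continuations _ _))
    obtain ⟨v1, hv1⟩ := ih (d :: k) v hm.1 (fun x hx => hk (Or.inl (Or.inr hx)))
    obtain ⟨v2, hv2⟩ := ih' k v1 hm.2 (fun x hx => hk (Or.inr hx))
    refine ⟨v2, ?_⟩
    rw [add_comm _ 1]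
    refine Steps.trans (v' := v) (k' := c :: d :: k) (s' := s) ?_ (hv1.trans hv2)
    simp [Steps, flip, h1, statement]
  | @popCase_nil r c d s s' t hr h ih =>
    intro k v hm hk
    have h1 := toLabel_val (hk (self_mem_continuations _ _))
    obtain ⟨v1, hv1⟩ := ih k none hm.2.1 (fun x hx => hk (Or.inl (Or.inr hx)))
    refine ⟨v1, ?_⟩
    rw [add_comm _ 1]
    refine Steps.trans ?_ hv1
    have h2 : update s r [] = s := by rw [← hr, update_eq_self]
    simp [Steps, flip, h1, statement, toStacks_stack hm.1, hr, update_toStacks hm.1, h2]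
  | @popCase_cons r c d s s' t x l hr h ih =>
    intro k v hm hk
    have h1 := toLabel_val (hk (self_mem_continuations _ _))
    obtain ⟨v1, hv1⟩ := ih k (some x) (hm.2.2 x)
      (fun y hy => hk (Or.inr (Set.mem_iUnion.2 ⟨x, hy⟩)))
    refine ⟨v1, ?_⟩
    rw [add_comm _ 1]
    refine Steps.trans ?_ hv1
    simp [Steps, flip, h1, statement, toStacks_stack hm.1, hr, update_toStacks hm.1]
  | @popWhile_nil r d s hr =>
    intro k v hm hk
    have h1 := toLabel_val (hk (self_mem_continuations _ _))
    refine ⟨none, ?_⟩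
    have h2 : update s r [] = s := by rw [← hr, update_eq_self]
    simp [Steps, flip, h1, statement, toStacks_stack hm.1, hr, update_toStacks hm.1, h2]
  | @popWhile_cons r d s s' s'' t t' x l hr h h' ih ih' =>
    intro k v hm hk
    have h1 := toLabel_val (hk (self_mem_continuations _ _))
    obtain ⟨v1, hv1⟩ := ih (.popWhile r d :: k) (some x) (hm.2 x)
      (fun y hy => hk (Or.inr (Set.mem_iUnion.2 ⟨x, hy⟩)))
    obtain ⟨v2, hv2⟩ := ih' k v1 hm hk
    refine ⟨v2, ?_⟩
    rw [add_comm _ 1]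
    refine Steps.trans ?_ (hv1.trans hv2)
    simp [Steps, flip, h1, statement, toStacks_stack hm.1, hr, update_toStacks hm.1]

/-- Polynomial-time programs for decision problems yield polynomial-time Turing machines. -/
theorem nonempty_computableInPolyTime {α : Type} (enc : α → List Γ') (f : α → Bool) (c : Cmd)
    (p : Polynomial ℕ)
    (h : ∀ a, ∃ t ≤ p.eval (enc a).length,
      Exec c (update (fun _ => []) 0 (enc a)) (update (fun _ => []) 0 [Γ'.bit (f a)]) t) :
    Nonempty (Turing.TM2ComputableInPolyTime enc encodeBool f) := by
  obtain ⟨m, hm⟩ := c.exists_stacksLE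
  refine ⟨{ tm := machine c m
            inputAlphabet := Equiv.refl Γ'
            outputAlphabet := Equiv.refl Bool
            -- The extra step is the statement of the empty continuation, which writes the answer on
            -- the output stack and halts.
            time := p + 1
            outputsFun := fun a => Classical.choice ?_ }⟩
  obtain ⟨t, ht, hex⟩ := h a
  obtain ⟨v, hv⟩ := hex.steps (c₀ := c) [] none hm (Set.subset_insert _ _)
  have hinit : Turing.initList (machine c m) (enc a) =
      ⟨some (toLabel c [c]), none, toStacks m (update (fun _ => []) 0 (enc a))⟩ := by
    unfold Turing.initList
    refine congrArg _ ?_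
    funext k
    rw [← update_toStacks (Nat.zero_le m)]
    cases k with
    | none => rfl
    | some i =>
      by_cases hi : i = 0
      · subst hi; rfl
      · rw [update_of_ne (by simpa [Fin.ofNat] using hi)]
        exact dif_neg (by simpa [machine, Fin.ofNat] using hi)
  refine ⟨⟨⟨1 + t, ?_⟩, ?_⟩⟩
  · rw [Function.iterate_add_apply]
    have h1 : List.map (Equiv.refl Γ').invFun (enc a) = enc a := List.map_id _
    have h2 : List.map (Equiv.refl Bool).invFun (encodeBool (f a)) = [f a] := rfl
    have h3 := toLabel_val (Set.mem_insert [] (continuations c []))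
    refine Eq.trans (congrArg _ (Eq.trans (congrArg _ ?_) hv)) ?_
    · exact congrArg some ((congrArg _ h1).trans hinit)
    · rw [Function.iterate_one]
      have h4 : Turing.haltList (machine c m) [f a] = ⟨none, none,
          update (toStacks m (fun _ => [])) none [f a]⟩ := by
        unfold Turing.haltList
        refine congrArg _ ?_
        funext k
        cases k with
        | none => rfl
        | some i =>
          refine (dif_neg (Option.some_ne_none i)).trans ?_
          rfl
      refine Eq.trans ?_ (congrArg some ((congrArg _ h2).trans h4).symm)
      change Turing.TM2.step (fun l : Label c => statement c m l.1) ⟨some (toLabel c []), v,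
        toStacks m (update (fun _ => []) 0 [Γ'.bit (f a)])⟩ = _
      rw [Turing.TM2.step, h3]
      refine congrArg some ?_
      simp only [statement, Turing.TM2.stepAux]
      rw [toStacks_stack (Nat.zero_le m), update_toStacks (Nat.zero_le m)]
      simp only [update_self, update_idem, List.tail_cons, List.head?_cons]
      have h5 : update (fun _ : ℕ => ([] : List Γ')) 0 [] = fun _ => [] :=
        update_eq_self_iff.2 rfl
      rw [h5]
      simp [toStacks]
      rfl
  · have h1 : List.map (Equiv.refl Γ').invFun (enc a) = enc a := List.map_id _
    simp only [Polynomial.eval_add, Polynomial.eval_one]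
    omega

end StackProgram

end

section

open Function Computability

namespace StackProgram

/-! ### Time bounds for programs -/

/-- `Run c s s' T`: started with the stacks `s`, the program `c` ends with the stacks `s'` after at
most `T` steps. -/
def Run (c : Cmd) (s s' : Store) (T : ℕ) : Prop := ∃ t ≤ T, Exec c s s' t

theorem Run.congr {c s s' s'' T T'} (h : Run c s s' T) (hs : s' = s'') (hT : T ≤ T') :
    Run c s s'' T' := by
  obtain ⟨t, ht, h⟩ := h
  exact ⟨t, ht.trans hT, hs ▸ h⟩

theorem Run.skip (s) : Run .skip s s 1 := ⟨1, le_rfl, .skip s⟩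

theorem Run.push (r x s) : Run (.push r x) s (update s r (x :: s r)) 1 := ⟨1, le_rfl, .push r x s⟩

theorem Run.seq {c d s s' s'' T T'} (h : Run c s s' T) (h' : Run d s' s'' T') :
    Run (c ;; d) s s'' (T + T' + 1) := by
  obtain ⟨t, ht, h⟩ := h
  obtain ⟨t', ht', h'⟩ := h'
  exact ⟨_, by omega, .seq h h'⟩

theorem Run.popCase_cons {r c d s s' T x l} (hr : s r = x :: l)
    (h : Run (d x) (update s r l) s' T) : Run (.popCase r c d) s s' (T + 1) := by
  obtain ⟨t, ht, h⟩ := h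
  exact ⟨_, by omega, .popCase_cons hr h⟩

theorem Run.popWhile_nil {r d s} (hr : s r = []) : Run (.popWhile r d) s s 1 :=
  ⟨1, le_rfl, .popWhile_nil hr⟩

theorem Run.popWhile_cons {r d s s' s'' T T' x l} (hr : s r = x :: l)
    (h : Run (d x) (update s r l) s' T) (h' : Run (.popWhile r d) s' s'' T') :
    Run (.popWhile r d) s s'' (T + T' + 1) := by
  obtain ⟨t, ht, h⟩ := h
  obtain ⟨t', ht', h'⟩ := h'
  exact ⟨_, by omega, .popWhile_cons hr h h'⟩

theorem Run.length_le {c s s' T} (h : Run c s s' T) (r : ℕ) :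
    (s' r).length ≤ (s r).length + T := by
  obtain ⟨t, ht, h⟩ := h
  have := h.length_le r
  omega

/-! ### Stores with four named stacks -/

/-- The store that agrees with `s` below `r`, holds `w`, `x`, `y`, `z` on the stacks from `r` on,
and nothing above. -/
def put (s : Store) (r : ℕ) (w x y z : List Γ') : Store := fun j =>
  if j < r then s j else if j = r then w else if j = r + 1 then x else if j = r + 2 then y
  else if j = r + 3 then z else []

section put
variable (s : Store) (r : ℕ) (w x y z l : List Γ')

@[simp] theorem put_zero : put s r w x y z r = w := by simp [put]
@[simp] theorem put_one : put s r w x y z (r + 1) = x := by simp [put]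
@[simp] theorem put_two : put s r w x y z (r + 2) = y := by simp [put]
@[simp] theorem put_three : put s r w x y z (r + 3) = z := by simp [put]

@[simp] theorem update_put_zero : update (put s r w x y z) r l = put s r l x y z := by
  funext j; by_cases h : j = r <;> simp [put, h]

@[simp] theorem update_put_one : update (put s r w x y z) (r + 1) l = put s r w l y z := by
  funext j; by_cases h : j = r + 1 <;> simp [put, h]

@[simp] theorem update_put_two : update (put s r w x y z) (r + 2) l = put s r w x l z := by
  funext j; by_cases h : j = r + 2 <;> simp [put, h]

@[simp] theorem update_put_three : update (put s r w x y z) (r + 3) l = put s r w x y l := by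
  funext j; by_cases h : j = r + 3 <;> simp [put, h]

/-- A subprogram can work from stack `r + 1` upwards while stack `r` keeps a saved value: the store
it sees has the same shape, shifted by one. -/
theorem put_put_succ (v : List Γ') : put (put s r v l [] []) (r + 1) w x y [] = put s r v w x y := by
  funext j
  simp only [put]
  split_ifs <;> first | rfl | omega

end put

/-! ### Auxiliary programs -/

/-- Empty the stack `r`. -/
def clear (r : ℕ) : Cmd := .popWhile r fun _ => .skip

/-- Move the stack `a` to the stack `b`, in reverse order. -/
def moveRev (a b : ℕ) : Cmd := .popWhile a fun x => .push b x

/-- Move the stack `a` to the two stacks `b` and `c`, in reverse order. -/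
def moveRev₂ (a b c : ℕ) : Cmd := .popWhile a fun x => .push b x ;; .push c x

theorem run_clear {s : Store} {r : ℕ} {l : List Γ'} (h : s r = l) :
    Run (clear r) s (update s r []) (2 * l.length + 1) := by
  induction l generalizing s with
  | nil => exact (Run.popWhile_nil h).congr (update_eq_self_iff.2 h.symm).symm (by simp)
  | cons x l ih =>
    refine (Run.popWhile_cons h (Run.skip _) (ih (by simp))).congr (by simp) ?_
    simp; omega

theorem run_moveRev {s : Store} {a b : ℕ} {l : List Γ'} (hab : a ≠ b) (h : s a = l) :
    Run (moveRev a b) s (update (update s a []) b (l.reverse ++ s b)) (2 * l.length + 1) := by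
  induction l generalizing s with
  | nil =>
    refine (Run.popWhile_nil h).congr ?_ (by simp)
    rw [(update_eq_self_iff (f := s) (a := a)).2 h.symm]; simp
  | cons x l ih =>
    refine (Run.popWhile_cons h (Run.push _ _ _) (ih (by simp [hab]))).congr ?_ ?_
    · funext j
      by_cases h1 : j = b
      · subst h1; simp [hab.symm]
      · by_cases h2 : j = a
        · subst h2; simp [hab]
        · simp [h1, h2]
    · simp; omega

theorem run_moveRev₂ {s : Store} {a b c : ℕ} {l : List Γ'} (hab : a ≠ b) (hac : a ≠ c)
    (hbc : b ≠ c) (h : s a = l) :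
    Run (moveRev₂ a b c) s
      (update (update (update s a []) b (l.reverse ++ s b)) c (l.reverse ++ s c))
      (4 * l.length + 1) := by
  induction l generalizing s with
  | nil =>
    refine (Run.popWhile_nil h).congr ?_ (by simp)
    rw [(update_eq_self_iff (f := s) (a := a)).2 h.symm]; simp
  | cons x l ih =>
    refine (Run.popWhile_cons h ((Run.push _ _ _).seq (Run.push _ _ _))
      (ih (by simp [hab, hac]))).congr ?_ ?_
    · funext j
      by_cases h1 : j = b
      · subst h1; simp [hab.symm, hbc]
      · by_cases h2 : j = a
        · subst h2; simp [hab, hac]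
        · by_cases h3 : j = c
          · subst h3; simp [hac.symm, h1]
          · simp [h1, h2, h3]
    · simp; omega

/-! ### Data -/

/-- The data that our programs compute with. -/
inductive Data : Type
  | nil
  | cons (x y : Data)

namespace Data

/-- The word that represents a datum on a stack. -/
def text : Data → List Γ'
  | nil => [.bit false]
  | cons x y => .bit true :: (x.text ++ y.text)

/-- The length of the representation of a datum. -/
def size (x : Data) : ℕ := x.text.length

@[simp] theorem size_nil : nil.size = 1 := rfl

@[simp] theorem size_cons (x y : Data) : (cons x y).size = x.size + y.size + 1 := by
  simp [size, text]

theorem size_pos (x : Data) : 0 < x.size := by cases x <;> simp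

/-- The first component. -/
def fst : Data → Data
  | nil => nil
  | cons x _ => x

/-- The second component. -/
def snd : Data → Data
  | nil => nil
  | cons _ y => y

/-- Whether the datum is `nil`. -/
def isNil : Data → Bool
  | nil => true
  | cons _ _ => false

end Data

/-- As long as the stack `cnt` is not empty, pop a symbol from it and move one datum from the stack
`src` to the stack `dst`, in reverse order. -/
def moveData (src cnt dst : ℕ) : Cmd := .popWhile cnt fun _ => .popCase src .skip fun x =>
  .push dst x ;; if x = .bit true then .push cnt .comma ;; .push cnt .comma else .skip

/-- Replace the contents of three stacks. -/
def update₃ (s : Store) (a b c : ℕ) (x y z : List Γ') : Store :=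
  update (update (update s a x) b y) c z

section update₃
variable (s : Store) {a b c : ℕ} (x y z l : List Γ')

theorem update₃_fst (hab : a ≠ b) (hac : a ≠ c) : update₃ s a b c x y z a = x := by
  simp [update₃, hab, hac]

theorem update₃_snd (hbc : b ≠ c) : update₃ s a b c x y z b = y := by simp [update₃, hbc]

theorem update₃_trd : update₃ s a b c x y z c = z := by simp [update₃]

theorem update_update₃_fst (hab : a ≠ b) (hac : a ≠ c) :
    update (update₃ s a b c x y z) a l = update₃ s a b c l y z := by
  funext j; by_cases h : j = a <;> simp [update₃, update_apply, h, hab, hac]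

theorem update_update₃_snd (hbc : b ≠ c) :
    update (update₃ s a b c x y z) b l = update₃ s a b c x l z := by
  funext j; by_cases h : j = b <;> simp [update₃, update_apply, h, hbc]

theorem update_update₃_trd : update (update₃ s a b c x y z) c l = update₃ s a b c x y l := by
  simp [update₃]

end update₃

/-- This is stated in continuation style: a run from the situation after the datum extends to one
from before it. The two components of a pair can then be chained. The stack `b` counts the data
still to be read, and a pair replaces its own mark by two. Each symbol costs at most seven steps. -/
theorem Run.moveData_step (s : Store) {a b c : ℕ} (hab : a ≠ b) (hac : a ≠ c) (hbc : b ≠ c)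
    (x : Data) {s' : Store} {T : ℕ} {u : Γ'} {l l' l'' : List Γ'}
    (h : Run (moveData a b c) (update₃ s a b c l' l (x.text.reverse ++ l'')) s' T) :
    Run (moveData a b c) (update₃ s a b c (x.text ++ l') (u :: l) l'') s' (T + 7 * x.size) := by
  induction x generalizing T u l l' l'' with
  | nil =>
    have h1 := (Run.push c (.bit false) (update₃ s a b c l' l l'')).seq (Run.skip _)
    rw [update₃_trd, update_update₃_trd] at h1
    refine (Run.popWhile_cons (x := u) (l := l) (update₃_snd _ _ _ _ hbc) ?_ h).congr
      (T := 5 + T + 1) rfl (by simp; omega)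
    rw [update_update₃_snd _ _ _ _ _ hbc]
    refine Run.popCase_cons (x := .bit false) (l := l') (update₃_fst _ _ _ _ hab hac) ?_
    rw [update_update₃_fst _ _ _ _ _ hab hac]
    exact h1.congr rfl (by omega)
  | cons x y ihx ihy =>
    -- The second component is moved last, so its run is built first and the run for the first
    -- component is put in front of it.
    have hy := ihy (u := .comma) (l := l) (l' := l') (l'' := x.text.reverse ++ .bit true :: l'')
      (T := T) (by simpa [Data.text] using h)
    have hx := ihx (u := .comma) (l := .comma :: l) (l' := y.text ++ l') (l'' := .bit true :: l'') hy
    have h1 := (Run.push c (.bit true) (update₃ s a b c (x.text ++ (y.text ++ l')) l l'')).seq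
      ((Run.push b .comma _).seq (Run.push b .comma _))
    rw [update₃_trd, update_update₃_trd, update_update₃_snd _ _ _ _ _ hbc,
      update_update₃_snd _ _ _ _ _ hbc, update₃_snd _ _ _ _ hbc, update₃_snd _ _ _ _ hbc] at h1
    refine (Run.popWhile_cons (x := u) (l := l) (update₃_snd _ _ _ _ hbc) ?_ hx).congr
      (T := 6 + (T + 7 * y.size + 7 * x.size) + 1) rfl (by simp; omega)
    rw [update_update₃_snd _ _ _ _ _ hbc]
    refine Run.popCase_cons (x := .bit true) (l := x.text ++ (y.text ++ l')) ?_ ?_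
    · rw [update₃_fst _ _ _ _ hab hac]
      simp [Data.text]
    · rw [update_update₃_fst _ _ _ _ _ hab hac]
      exact h1.congr rfl (by omega)

theorem run_moveData (s : Store) {a b c : ℕ} (hab : a ≠ b) (hac : a ≠ c) (hbc : b ≠ c)
    (x : Data) {u : Γ'} {l : List Γ'} (ha : s a = x.text ++ l) (hb : s b = [u]) (hc : s c = []) :
    Run (moveData a b c) s (update (update (update s a l) b []) c x.text.reverse)
      (1 + 7 * x.size) := by
  have h := Run.moveData_step s hab hac hbc x (u := u) (l := []) (l' := l) (l'' := [])
    (Run.popWhile_nil (update₃_snd _ _ _ _ hbc))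
  rw [List.append_nil] at h
  convert! h using 1
  rw [update₃, ← ha, update_eq_self, ← hb, update_eq_self, ← hc, update_eq_self]

end StackProgram

end

/-! ### A calculus of polynomial-time functions. -/

section

open Function Computability

set_option linter.unusedSimpArgs false

namespace StackProgram

/-! ### Functions that are computable in polynomial time -/

/-- A representation of the elements of a type by data. -/
class Code (α : Type) where
  /-- The datum that represents an element. -/
  enc : α → Data

open Code

instance : Code Data := ⟨id⟩

variable {α β γ δ : Type} [Code α] [Code β] [Code γ] [Code δ]

/-- The word that represents an element. -/
def ctext (a : α) : List Γ' := (enc a).text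

/-- The length of the word that represents an element. -/
def csize (a : α) : ℕ := (enc a).size

theorem Data.length_text (x : Data) : x.text.length = x.size := rfl

theorem length_ctext (a : α) : (ctext a).length = csize a := rfl

/-- The function `f` can be computed in polynomial time by a program that overwrites the
representation of the argument with that of the result, using the empty stacks above. -/
@[fun_prop] def PTime (f : α → β) : Prop :=
  ∃ (c : ℕ → Cmd) (p : Polynomial ℕ), ∀ (r : ℕ) (s : Store) (a : α),
    Run (c r) (put s r (ctext a) [] [] []) (put s r (ctext (f a)) [] [] []) (p.eval (csize a))

theorem eval_le_eval (p : Polynomial ℕ) {m n : ℕ} (h : m ≤ n) : p.eval m ≤ p.eval n := by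
  simp only [Polynomial.eval_eq_sum_range]
  gcongr

/-- The output is no longer than the input plus the running time. Together with the monotonicity of
polynomials over `ℕ` this bounds the time of a second program in terms of the original input. -/
theorem PTime.csize_le {f : α → β} (hf : PTime f) :
    ∃ p : Polynomial ℕ, ∀ a, csize (f a) ≤ p.eval (csize a) := by
  obtain ⟨c, p, h⟩ := hf
  refine ⟨.X + p, fun a => ?_⟩
  have := (h 0 (fun _ => []) a).length_le 0
  rw [put_zero, put_zero, length_ctext, length_ctext] at this
  simpa using this

@[fun_prop] theorem PTime.id : PTime fun a : α => a :=
  ⟨fun _ => .skip, 1, fun _ _ _ => (Run.skip _).congr rfl (by simp)⟩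

@[fun_prop] theorem PTime.enc {f : α → β} (hf : PTime f) : PTime fun a => enc (f a) := hf

/-- `PTime` sees only the data that represent the values. A function may therefore be replaced by
another one, even into a different type, that has the same codes. -/
theorem PTime.of_enc {f : α → β} (hf : PTime fun a => Code.enc (f a)) : PTime f := hf

theorem PTime.congr {f g : α → β} (hf : PTime f) (h : ∀ a, f a = g a) : PTime g :=
  (funext h : f = g) ▸ hf

/-- Push a word. -/
def pushWord (r : ℕ) : List Γ' → Cmd
  | [] => .skip
  | x :: l => pushWord r l ;; .push r x

theorem run_pushWord (s : Store) (r : ℕ) (l : List Γ') :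
    Run (pushWord r l) s (update s r (l ++ s r)) (2 * l.length + 1) := by
  induction l with
  | nil => exact (Run.skip _).congr (by simp) (by simp)
  | cons x l ih => exact (ih.seq (Run.push _ _ _)).congr (by simp) (by simp; omega)

@[fun_prop] theorem PTime.const (b : β) : PTime fun _ : α => b := by
  refine ⟨fun r => clear r ;; pushWord r (ctext b), 2 * .X + .C (2 * csize b + 3),
    fun r s a => ?_⟩
  refine ((run_clear (put_zero _ _ _ _ _ _)).seq (run_pushWord _ _ _)).congr (by simp) ?_
  simp [length_ctext]; omega

theorem PTime.comp {g : β → γ} {f : α → β} (hg : PTime g) (hf : PTime f) :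
    PTime fun a => g (f a) := by
  obtain ⟨q, hq⟩ := hf.csize_le
  obtain ⟨c, p, h⟩ := hf
  obtain ⟨c', p', h'⟩ := hg
  refine ⟨fun r => c r ;; c' r, p + p'.comp q + 1, fun r s a => ?_⟩
  refine ((h r s a).seq (h' r s (f a))).congr rfl ?_
  have := eval_le_eval p' (hq a)
  simp only [Polynomial.eval_add, Polynomial.eval_comp, Polynomial.eval_one]
  omega

instance : Code (α × β) := ⟨fun x => .cons (enc x.1) (enc x.2)⟩

theorem csize_mk (a : α) (b : β) : csize (a, b) = csize a + csize b + 1 := Data.size_cons _ _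

/-- Copy the stack `r` to the stack `r + 1`. -/
def copy (r : ℕ) : Cmd := moveRev r (r + 2) ;; moveRev₂ (r + 2) r (r + 1)

theorem run_copy (s : Store) (r : ℕ) (l : List Γ') :
    Run (copy r) (put s r l [] [] []) (put s r l l [] []) (6 * l.length + 3) := by
  have h1 := run_moveRev (s := put s r l [] [] []) (a := r) (b := r + 2) (by omega) (put_zero ..)
  have h2 := run_moveRev₂ (s := put s r [] [] l.reverse []) (a := r + 2) (b := r) (c := r + 1)
    (by omega) (by omega) (by omega) (put_two ..)
  refine (h1.seq (h2.congr rfl le_rfl |> fun h => by simpa using h)).congr rfl ?_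
  simp; omega

-- The argument is copied, `f` is computed on the upper copy, the two stacks are exchanged, and `g`
-- is computed on the other copy. The results are then concatenated behind the symbol that marks a
-- pair.
@[fun_prop] theorem PTime.prodMk {f : α → β} {g : α → γ} (hf : PTime f) (hg : PTime g) :
    PTime fun a => (f a, g a) := by
  obtain ⟨q, hq⟩ := hf.csize_le
  obtain ⟨q', hq'⟩ := hg.csize_le
  obtain ⟨c, p, h⟩ := hf
  obtain ⟨c', p', h'⟩ := hg
  refine ⟨fun r => copy r ;; c (r + 1) ;; moveRev (r + 1) (r + 3) ;; moveRev r (r + 2) ;;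
    moveRev (r + 3) r ;; moveRev (r + 2) (r + 1) ;; c' (r + 1) ;; moveRev r (r + 2) ;;
    moveRev (r + 1) (r + 3) ;; moveRev (r + 3) r ;; moveRev (r + 2) r ;; .push r (.bit true),
    p + p' + 20 * .X + 20 * q + 20 * q' + 40, fun r s a => ?_⟩
  have h0 := run_copy s r (ctext a)
  have h1 := h (r + 1) (put s r (ctext a) [] [] []) a
  rw [put_put_succ, put_put_succ] at h1
  have h2 := run_moveRev (s := put s r (ctext a) (ctext (f a)) [] []) (a := r + 1) (b := r + 3)
    (by omega) (put_one ..)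
  have h3 := run_moveRev (s := put s r (ctext a) [] [] (ctext (f a)).reverse) (a := r) (b := r + 2)
    (by omega) (put_zero ..)
  have h4 := run_moveRev (s := put s r [] [] (ctext a).reverse (ctext (f a)).reverse) (a := r + 3)
    (b := r) (by omega) (put_three ..)
  have h5 := run_moveRev (s := put s r (ctext (f a)) [] (ctext a).reverse []) (a := r + 2)
    (b := r + 1) (by omega) (put_two ..)
  have h6 := h' (r + 1) (put s r (ctext (f a)) [] [] []) a
  rw [put_put_succ, put_put_succ] at h6
  have h7 := run_moveRev (s := put s r (ctext (f a)) (ctext (g a)) [] []) (a := r) (b := r + 2)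
    (by omega) (put_zero ..)
  have h8 := run_moveRev (s := put s r [] (ctext (g a)) (ctext (f a)).reverse []) (a := r + 1)
    (b := r + 3) (by omega) (put_one ..)
  have h9 := run_moveRev (s := put s r [] [] (ctext (f a)).reverse (ctext (g a)).reverse)
    (a := r + 3) (b := r) (by omega) (put_three ..)
  have h10 := run_moveRev (s := put s r (ctext (g a)) [] (ctext (f a)).reverse [])
    (a := r + 2) (b := r) (by omega) (put_two ..)
  have h11 := Run.push r (.bit true) (put s r (ctext (f a) ++ ctext (g a)) [] [] [])
  simp only [update_put_zero, update_put_one, update_put_two, update_put_three, put_zero, put_one,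
    put_two, put_three, List.append_nil, List.reverse_reverse] at h2 h3 h4 h5 h7 h8 h9 h10 h11
  refine (h0.seq <| h1.seq <| h2.seq <| h3.seq <| h4.seq <| h5.seq <| h6.seq <| h7.seq <|
    h8.seq <| h9.seq <| h10.seq h11).congr rfl ?_
  have e1 := hq a
  have e2 := hq' a
  simp only [List.length_reverse, length_ctext, Polynomial.eval_add, Polynomial.eval_mul,
    Polynomial.eval_ofNat, Polynomial.eval_X]
  omega

/-- Replace the datum on the stack `r` with its first component. -/
def fstCmd (r : ℕ) : Cmd := .popCase r .skip fun x => if x = .bit true then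
  .push (r + 1) .comma ;; moveData r (r + 1) (r + 2) ;; clear r ;; moveRev (r + 2) r
  else .push r x

theorem PTime.dataFst : PTime Data.fst := by
  refine ⟨fstCmd, 20 * .X + 20, fun r s a => ?_⟩
  cases a with
  | nil =>
    refine Run.congr (T := 2) (Run.popCase_cons (x := .bit false) (l := []) (T := 1)
      (put_zero ..) ?_) rfl ?_
    · rw [if_neg (by simp), update_put_zero]
      exact (Run.push _ _ _).congr (by simp; rfl) le_rfl
    · simp
  | cons x y =>
    have h1 := Run.push (r + 1) .comma (put s r (x.text ++ y.text) [] [] [])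
    have h2 := run_moveData (put s r (x.text ++ y.text) [.comma] [] []) (a := r) (b := r + 1)
      (c := r + 2) (by omega) (by omega) (by omega) x (put_zero ..) (put_one ..) (put_two ..)
    have h3 := run_clear (put_zero s r y.text [] x.text.reverse [])
    have h4 := run_moveRev (s := put s r [] [] x.text.reverse []) (a := r + 2) (b := r)
      (by omega) (put_two ..)
    simp only [update_put_zero, update_put_one, update_put_two, update_put_three, put_zero, put_one,
      put_two, put_three, List.append_nil, List.reverse_reverse] at h1 h2 h3 h4
    refine (Run.popCase_cons (x := .bit true) (l := x.text ++ y.text) (put_zero ..) ?_).congr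
      (T := 9 * x.size + 2 * y.size + 10) rfl ?_
    · rw [if_pos rfl, update_put_zero]
      refine (h1.seq (h2.seq (h3.seq h4))).congr rfl ?_
      simp only [List.length_reverse, Data.length_text]
      omega
    · simp [csize, Code.enc]; omega

/-- Replace the datum on the stack `r` with its second component. -/
def sndCmd (r : ℕ) : Cmd := .popCase r .skip fun x => if x = .bit true then
  .push (r + 1) .comma ;; moveData r (r + 1) (r + 2) ;; clear (r + 2) else .push r x

theorem PTime.dataSnd : PTime Data.snd := by
  refine ⟨sndCmd, 20 * .X + 20, fun r s a => ?_⟩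
  cases a with
  | nil =>
    refine Run.congr (T := 2) (Run.popCase_cons (x := .bit false) (l := []) (T := 1)
      (put_zero ..) ?_) rfl ?_
    · rw [if_neg (by simp), update_put_zero]
      exact (Run.push _ _ _).congr (by simp; rfl) le_rfl
    · simp
  | cons x y =>
    have h1 := Run.push (r + 1) .comma (put s r (x.text ++ y.text) [] [] [])
    have h2 := run_moveData (put s r (x.text ++ y.text) [.comma] [] []) (a := r) (b := r + 1)
      (c := r + 2) (by omega) (by omega) (by omega) x (put_zero ..) (put_one ..) (put_two ..)
    have h3 := run_clear (put_two s r y.text [] x.text.reverse [])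
    simp only [update_put_zero, update_put_one, update_put_two, update_put_three, put_zero, put_one,
      put_two, put_three, List.append_nil, List.reverse_reverse] at h1 h2 h3
    refine (Run.popCase_cons (x := .bit true) (l := x.text ++ y.text) (put_zero ..) ?_).congr
      (T := 9 * x.size + 2 * y.size + 10) rfl ?_
    · rw [if_pos rfl, update_put_zero]
      refine (h1.seq (h2.seq h3)).congr rfl ?_
      simp only [List.length_reverse, Data.length_text]
      omega
    · simp [csize, Code.enc]; omega

@[fun_prop] theorem PTime.fst {f : α → β × γ} (hf : PTime f) : PTime fun a => (f a).1 :=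
  PTime.of_enc (PTime.dataFst.comp hf.enc)

@[fun_prop] theorem PTime.snd {f : α → β × γ} (hf : PTime f) : PTime fun a => (f a).2 :=
  PTime.of_enc (PTime.dataSnd.comp hf.enc)

/-- The test is computed on a copy of the argument. Its first symbol decides, since only the code of
a pair starts with `bit true`; in that case the rest of the test value has to be cleared. -/
theorem PTime.ite_isNil {t : α → Data} {f g : α → β} (ht : PTime t) (hf : PTime f)
    (hg : PTime g) : PTime fun a => if (t a).isNil = true then f a else g a := by
  obtain ⟨q, hq⟩ := ht.csize_le
  obtain ⟨c₀, p₀, h₀⟩ := ht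
  obtain ⟨c, p, h⟩ := hf
  obtain ⟨c', p', h'⟩ := hg
  refine ⟨fun r => copy r ;; c₀ (r + 1) ;; .popCase (r + 1) .skip fun x =>
    if x = .bit true then clear (r + 1) ;; c' r else c r,
    p + p' + p₀ + 20 * .X + 20 * q + 40, fun r s a => ?_⟩
  have e1 := run_copy s r (ctext a)
  have e2 := h₀ (r + 1) (put s r (ctext a) [] [] []) a
  rw [put_put_succ, put_put_succ] at e2
  have e3 := h r s a
  have e4 := h' r s a
  have e5 : (Code.enc (t a)).text.length ≤ q.eval (csize a) := hq a
  refine (e1.seq (e2.seq (s'' := put s r (ctext (if (t a).isNil = true then f a else g a)) [] [] [])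
    (T' := p.eval (csize a) + p'.eval (csize a) + 2 * q.eval (csize a) + 10) ?_)).congr rfl ?_
  · have hta : ctext (t a) = (t a).text := rfl
    have hta' : Code.enc (t a) = t a := rfl
    rw [hta'] at e5
    cases hx : t a with
    | nil =>
      refine (Run.popCase_cons (x := .bit false) (l := []) (T := p.eval (csize a))
        ?_ ?_).congr rfl ?_
      · rw [put_one]; rfl
      · rw [if_neg (by simp), update_put_one]
        exact e3
      · omega
    | cons x y =>
      rw [hx] at e5
      simp only [Data.text, List.length_cons] at e5
      refine (Run.popCase_cons (x := .bit true) (l := x.text ++ y.text)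
        (T := 2 * q.eval (csize a) + 1 + p'.eval (csize a) + 1) ?_ ?_).congr rfl ?_
      · rw [put_one]; rfl
      · rw [if_pos rfl, update_put_one]
        refine ((run_clear (put_one ..)).congr (s'' := put s r (ctext a) [] [] [])
          (T' := 2 * q.eval (csize a) + 1) (by simp) (by omega)).seq e4
      · omega
  · simp only [length_ctext, Polynomial.eval_add, Polynomial.eval_mul,
      Polynomial.eval_ofNat, Polynomial.eval_X]
    omega

/-! ### Iteration -/

/-- The number of elements of a datum that is read as a list. -/
def Data.len : Data → ℕ
  | .nil => 0
  | .cons _ y => y.len + 1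

/-- Run `c` on the stack `r + 1` for each element of the list on the stack `r`. -/
def iterateLoop (c : ℕ → Cmd) (r : ℕ) : Cmd := .popWhile r fun x => if x = .bit true then
  .push (r + 2) .comma ;; moveData r (r + 2) (r + 3) ;; clear (r + 3) ;; c (r + 1) else .skip

/-- The list on stack `r` serves only as a counter: its elements are moved off and discarded, one
for each application of `f`. -/
theorem run_iterateLoop {f : β → β} {c : ℕ → Cmd} {p : Polynomial ℕ}
    (h : ∀ (r : ℕ) (s : Store) (b : β),
      Run (c r) (put s r (ctext b) [] [] []) (put s r (ctext (f b)) [] [] []) (p.eval (csize b)))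
    (r : ℕ) (s : Store) (n : Data) (B : ℕ) (b : β) (hB : ∀ k ≤ n.len, csize (f^[k] b) ≤ B) :
    Run (iterateLoop c r) (put s r n.text (ctext b) [] [])
      (put s r [] (ctext (f^[n.len] b)) [] []) (n.size * (p.eval B + 10)) := by
  induction n generalizing b with
  | nil =>
    refine (Run.popWhile_cons (T := 1) (put_zero ..) ?_ (Run.popWhile_nil (put_zero ..))).congr
      rfl ?_
    · rw [if_neg (by simp), update_put_zero]
      exact Run.skip _
    · simp
  | cons x y _ ih =>
    have e0 := eval_le_eval p (hB 0 (Nat.zero_le _))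
    have h1 := Run.push (r + 2) .comma (put s r (x.text ++ y.text) (ctext b) [] [])
    have h2 := run_moveData (put s r (x.text ++ y.text) (ctext b) [.comma] []) (a := r) (b := r + 2)
      (c := r + 3) (by omega) (by omega) (by omega) x (put_zero ..) (put_two ..) (put_three ..)
    have h3 := run_clear (put_three s r y.text (ctext b) [] x.text.reverse)
    have h4 := h (r + 1) (put s r y.text (ctext b) [] []) b
    rw [put_put_succ, put_put_succ] at h4
    simp only [update_put_zero, update_put_one, update_put_two, update_put_three, put_zero, put_one,
      put_two, put_three] at h1 h2 h3
    have h5 := ih (f b) fun k hk => by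
      have := hB (k + 1) (by simpa [Data.len] using hk)
      rwa [iterate_succ_apply] at this
    refine (Run.popWhile_cons (x := .bit true) (l := x.text ++ y.text)
      (T := 9 * x.size + p.eval B + 7) (put_zero ..) ?_ h5).congr rfl ?_
    · rw [if_pos rfl, update_put_zero]
      refine (h1.seq (h2.seq (h3.seq h4))).congr rfl ?_
      simp only [List.length_reverse, Data.length_text]
      simp only [iterate_zero, id_eq] at e0
      omega
    · rw [Data.size_cons]
      have := x.size_pos
      nlinarith [Nat.zero_le (p.eval B * x.size)]

/-- The hypothesis on intermediate values is essential: a polynomial-time `f` may double the size of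
its argument, and iteration would then be exponential. -/
theorem PTime.iterate_len {f : β → β} {n : α → Data} {b : α → β} (hf : PTime f) (hn : PTime n)
    (hb : PTime b)
    (hB : ∃ q : Polynomial ℕ, ∀ a, ∀ k ≤ (n a).len, csize (f^[k] (b a)) ≤ q.eval (csize a)) :
    PTime fun a => f^[(n a).len] (b a) := by
  obtain ⟨q, hq⟩ := hB
  obtain ⟨q', hq'⟩ := (hn.prodMk hb).csize_le
  obtain ⟨c, p, h⟩ := hf
  obtain ⟨c₀, p₀, h₀⟩ := hn.prodMk hb
  refine ⟨fun r => c₀ r ;; .popCase r .skip fun _ => .push (r + 1) .comma ;;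
    moveData r (r + 1) (r + 2) ;; moveRev r (r + 3) ;; moveRev (r + 2) r ;;
    moveRev (r + 3) (r + 1) ;; iterateLoop c r ;; moveRev (r + 1) (r + 2) ;; moveRev (r + 2) r,
    p₀ + q' * (p.comp q + 10) + 20 * q' + 4 * q + 40, fun r s a => ?_⟩
  refine ((h₀ r s a).seq (Run.popCase_cons (x := .bit true) (l := (n a).text ++ ctext (b a))
    (T := (n a).size * (p.eval (q.eval (csize a)) + 10) + 9 * (n a).size + 4 * csize (b a)
      + 4 * q.eval (csize a) + 20) (put_zero ..) ?_)).congr rfl ?_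
  · rw [update_put_zero]
    have h1 := Run.push (r + 1) .comma (put s r ((n a).text ++ ctext (b a)) [] [] [])
    have h2 := run_moveData (put s r ((n a).text ++ ctext (b a)) [.comma] [] []) (a := r)
      (b := r + 1) (c := r + 2) (by omega) (by omega) (by omega) (n a) (put_zero ..) (put_one ..)
      (put_two ..)
    have h3 := run_moveRev (s := put s r (ctext (b a)) [] (n a).text.reverse []) (a := r)
      (b := r + 3) (by omega) (put_zero ..)
    have h4 := run_moveRev (s := put s r [] [] (n a).text.reverse (ctext (b a)).reverse)
      (a := r + 2) (b := r) (by omega) (put_two ..)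
    have h5 := run_moveRev (s := put s r (n a).text [] [] (ctext (b a)).reverse)
      (a := r + 3) (b := r + 1) (by omega) (put_three ..)
    have h6 := run_iterateLoop h r s (n a) _ (b a) (hq a)
    have h7 := run_moveRev (s := put s r [] (ctext (f^[(n a).len] (b a))) [] [])
      (a := r + 1) (b := r + 2) (by omega) (put_one ..)
    have h8 := run_moveRev (s := put s r [] [] (ctext (f^[(n a).len] (b a))).reverse [])
      (a := r + 2) (b := r) (by omega) (put_two ..)
    simp only [update_put_zero, update_put_one, update_put_two, update_put_three, put_zero, put_one,
      put_two, put_three, List.append_nil, List.reverse_reverse] at h1 h2 h3 h4 h5 h7 h8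
    refine (h1.seq <| h2.seq <| h3.seq <| h4.seq <| h5.seq <| h6.seq <| h7.seq h8).congr rfl ?_
    have e1 := hq a _ le_rfl
    simp only [List.length_reverse, length_ctext, Data.length_text]
    omega
  · have e2 := hq' a
    rw [csize_mk] at e2
    have e3 : csize (n a) = (n a).size := rfl
    have e4 : (n a).size * (p.eval (q.eval (csize a)) + 10) ≤
        q'.eval (csize a) * (p.eval (q.eval (csize a)) + 10) := Nat.mul_le_mul_right _ (by omega)
    simp only [Polynomial.eval_add, Polynomial.eval_mul, Polynomial.eval_comp,
      Polynomial.eval_ofNat]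
    omega

end StackProgram

end

section

open Function Computability

set_option linter.unusedSimpArgs false

namespace StackProgram

open Code

variable {α β γ δ : Type} [Code α] [Code β] [Code γ] [Code δ]

/-! ### Truth values -/

instance : Code Unit := ⟨fun _ => .nil⟩

instance : Code Bool := ⟨fun b => cond b (.cons .nil .nil) .nil⟩

theorem csize_bool_le (b : Bool) : csize b ≤ 3 := by cases b <;> simp [csize, Code.enc]

@[fun_prop] theorem PTime.ite {P : α → Prop} [DecidablePred P] {f g : α → β}
    (hP : PTime fun a => decide (P a)) (hf : PTime f) (hg : PTime g) :
    PTime fun a => if P a then f a else g a := by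
  refine (PTime.ite_isNil hP.enc hg hf).congr fun a => ?_
  by_cases h : P a <;> simp [h, Code.enc, Data.isNil]

@[fun_prop] theorem PTime.decide_eq_true {f : α → Bool} (hf : PTime f) :
    PTime fun a => decide (f a = true) := hf.congr fun a => by simp

theorem PTime.decide_congr {P Q : α → Prop} [DecidablePred P] [DecidablePred Q]
    (hP : PTime fun a => decide (P a)) (h : ∀ a, P a ↔ Q a) : PTime fun a => decide (Q a) :=
  hP.congr fun a => by simp [h]

@[fun_prop] theorem PTime.decide_not {P : α → Prop} [DecidablePred P]
    (hP : PTime fun a => decide (P a)) : PTime fun a => decide (¬ P a) :=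
  (PTime.ite hP (.const false) (.const true)).congr fun a => by by_cases h : P a <;> simp [h]

@[fun_prop] theorem PTime.decide_and {P Q : α → Prop} [DecidablePred P] [DecidablePred Q]
    (hP : PTime fun a => decide (P a)) (hQ : PTime fun a => decide (Q a)) :
    PTime fun a => decide (P a ∧ Q a) :=
  (PTime.ite hP hQ (.const false)).congr fun a => by by_cases h : P a <;> simp [h]

@[fun_prop] theorem PTime.decide_or {P Q : α → Prop} [DecidablePred P] [DecidablePred Q]
    (hP : PTime fun a => decide (P a)) (hQ : PTime fun a => decide (Q a)) :
    PTime fun a => decide (P a ∨ Q a) :=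
  (PTime.ite hP (.const true) hQ).congr fun a => by by_cases h : P a <;> simp [h]

/-! ### Lists -/

/-- The datum of a list. -/
def encList : List α → Data
  | [] => .nil
  | x :: l => .cons (enc x) (encList l)

instance : Code (List α) := ⟨encList⟩

@[simp] theorem enc_nil : enc ([] : List α) = .nil := rfl

@[simp] theorem enc_cons (x : α) (l : List α) : enc (x :: l) = .cons (enc x) (enc l) := rfl

@[simp] theorem csize_nil : csize ([] : List α) = 1 := rfl

@[simp] theorem csize_cons (x : α) (l : List α) : csize (x :: l) = csize x + csize l + 1 := by
  simp [csize]

@[simp] theorem len_enc (l : List α) : (enc l).len = l.length := by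
  induction l with
  | nil => rfl
  | cons x l ih => simp [Data.len, ih]

theorem length_le_csize (l : List α) : l.length ≤ csize l := by
  induction l with
  | nil => simp
  | cons x l ih => simp; omega

theorem csize_le_of_mem {l : List α} {x : α} (h : x ∈ l) : csize x ≤ csize l := by
  induction l with
  | nil => simp at h
  | cons y l ih =>
    rcases List.mem_cons.1 h with rfl | h
    · simp; omega
    · have := ih h; simp; omega

theorem csize_drop_le (k : ℕ) (l : List α) : csize (l.drop k) ≤ csize l := by
  induction l generalizing k with
  | nil => simp
  | cons x l ih =>
    cases k with
    | zero => simp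
    | succ k => have := ih k; simp; omega

theorem csize_list_le {l : List α} {B : ℕ} (h : ∀ x ∈ l, csize x ≤ B) :
    csize l ≤ l.length * (B + 1) + 1 := by
  induction l with
  | nil => simp
  | cons x l ih =>
    have h1 := h x (by simp)
    have h2 := ih fun y hy => h y (by simp [hy])
    simp only [csize_cons, List.length_cons, add_mul]
    omega

@[fun_prop] theorem PTime.cons {f : α → β} {l : α → List β} (hf : PTime f) (hl : PTime l) :
    PTime fun a => f a :: l a := (hf.prodMk hl : PTime fun a => (f a, l a))

@[fun_prop] theorem PTime.tail {l : α → List β} (hl : PTime l) : PTime fun a => (l a).tail := by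
  refine PTime.of_enc ((PTime.dataSnd.comp hl.enc).congr fun a => ?_)
  cases l a <;> rfl

@[fun_prop] theorem PTime.decide_eq_nil [DecidableEq β] {l : α → List β} (hl : PTime l) :
    PTime fun a => decide (l a = []) :=
  (PTime.ite_isNil hl.enc (.const true) (.const false)).congr fun a => by
    cases l a <;> simp [Data.isNil]

@[fun_prop] theorem PTime.headD {l : α → List β} {d : α → β} (hl : PTime l) (hd : PTime d) :
    PTime fun a => (l a).headD (d a) := by
  refine PTime.of_enc ((PTime.ite_isNil hl.enc hd.enc (PTime.dataFst.comp hl.enc)).congr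
    fun a => ?_)
  cases l a <;> rfl

theorem PTime.iterate_length {f : β → β} {n : α → List γ} {b : α → β} (hf : PTime f)
    (hn : PTime n) (hb : PTime b)
    (hB : ∃ q : Polynomial ℕ, ∀ a, ∀ k ≤ (n a).length, csize (f^[k] (b a)) ≤ q.eval (csize a)) :
    PTime fun a => f^[(n a).length] (b a) := by
  obtain ⟨q, hq⟩ := hB
  exact (PTime.iterate_len hf hn.enc hb ⟨q, fun a k hk => hq a k (by simpa using hk)⟩).congr
    fun a => by simp

/-- One step of a fold over a list. -/
def foldStep {α β γ : Type} [Code β] [Inhabited β] (g : α → γ → β → γ)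
    (s : α × γ × List β) : α × γ × List β :=
  if (enc s.2.2).isNil = true then s else (s.1, g s.1 s.2.1 (s.2.2.headD default), s.2.2.tail)

theorem iterate_foldStep {α β γ : Type} [Code β] [Inhabited β] (g : α → γ → β → γ) (a : α)
    (c : γ) (l : List β) (k : ℕ)
    (hk : k ≤ l.length) :
    (foldStep g)^[k] (a, c, l) = (a, (l.take k).foldl (g a) c, l.drop k) := by
  induction k generalizing c l with
  | zero => simp
  | succ k ih =>
    cases l with
    | nil => simp at hk
    | cons b l =>
      rw [iterate_succ_apply]
      simpa [foldStep, Data.isNil] using ih (g a c b) l (by simpa using hk)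

/-- The fold is an iteration of `foldStep` on the parameter, the accumulator and the rest of the
list, so its intermediate accumulators are the folds over prefixes. The default element of `β` is
never used, because the head is taken only of nonempty lists. -/
theorem PTime.foldl_of_prefix [Inhabited β] {l : α → List β} {c : α → γ} {g : α → γ → β → γ}
    (hl : PTime l) (hc : PTime c) (hg : PTime fun p : α × γ × β => g p.1 p.2.1 p.2.2)
    (hB : ∃ q : Polynomial ℕ, ∀ a l', l' <+: l a →
      csize (l'.foldl (g a) (c a)) ≤ q.eval (csize a)) :
    PTime fun a => (l a).foldl (g a) (c a) := by
  obtain ⟨q, hq⟩ := hB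
  obtain ⟨q', hq'⟩ := hl.csize_le
  have hstep : PTime (foldStep g : α × γ × List β → _) := by
    refine PTime.ite_isNil (by fun_prop) (by fun_prop) (PTime.prodMk (by fun_prop)
      (PTime.prodMk ?_ (by fun_prop)))
    exact hg.comp (f := fun s : α × γ × List β => (s.1, s.2.1, s.2.2.headD default)) (by fun_prop)
  have h := PTime.iterate_length (n := l) (b := fun a => (a, c a, l a)) hstep hl (by fun_prop)
    ⟨.X + q + q' + 2, fun a k hk => ?_⟩
  · refine h.snd.fst.congr fun a => ?_
    rw [iterate_foldStep _ _ _ _ _ le_rfl]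
    simp
  · rw [iterate_foldStep _ _ _ _ _ hk, csize_mk, csize_mk]
    have h1 := hq a _ (List.take_prefix k (l a))
    have h2 := (csize_drop_le k (l a)).trans (hq' a)
    simp only [Polynomial.eval_add, Polynomial.eval_X, Polynomial.eval_ofNat]
    omega

/-- If one step adds to the measure an amount that does not depend on the accumulator, the total
growth is at most the length of the list times that amount. A measure other than the code size is
convenient for binary numbers, where it is the number of bits. -/
theorem PTime.foldl_of_measure [Inhabited β] {l : α → List β} {c : α → γ} {g : α → γ → β → γ}
    (hl : PTime l) (hc : PTime c) (hg : PTime fun p : α × γ × β => g p.1 p.2.1 p.2.2)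
    (μ : γ → ℕ) (p₀ p₁ p₂ : Polynomial ℕ) (h₀ : ∀ x, csize x ≤ p₀.eval (μ x))
    (h₁ : ∀ x, μ x ≤ p₁.eval (csize x))
    (h₂ : ∀ a x b, μ (g a x b) ≤ μ x + p₂.eval (csize a + csize b)) :
    PTime fun a => (l a).foldl (g a) (c a) := by
  obtain ⟨q, hq⟩ := hl.csize_le
  obtain ⟨q', hq'⟩ := hc.csize_le
  refine PTime.foldl_of_prefix hl hc hg ⟨p₀.comp (p₁.comp q' + q * p₂.comp (.X + q)),
    fun a l' hl' => ?_⟩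
  have key : ∀ (l' : List β) (x : γ), (∀ b ∈ l', csize b ≤ q.eval (csize a)) →
      μ (l'.foldl (g a) x) ≤ μ x + l'.length * p₂.eval (csize a + q.eval (csize a)) := by
    intro l'
    induction l' with
    | nil => simp
    | cons b l' ih =>
      intro x hx
      have e1 := ih (g a x b) fun b' hb' => hx b' (by simp [hb'])
      have e2 := h₂ a x b
      have e3 := eval_le_eval p₂ (Nat.add_le_add_left (hx b (by simp)) (csize a))
      simp only [List.foldl_cons, List.length_cons, add_mul, one_mul]
      omega
  have e1 := key l' (c a) fun b hb => (csize_le_of_mem (hl'.subset hb)).trans (hq a)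
  have e2 := (h₁ (c a)).trans (eval_le_eval p₁ (hq' a))
  have e3 : l'.length ≤ q.eval (csize a) :=
    (hl'.length_le.trans (length_le_csize _)).trans (hq a)
  refine (h₀ _).trans ?_
  rw [Polynomial.eval_comp]
  refine eval_le_eval _ ?_
  have e4 := Nat.mul_le_mul_right (p₂.eval (csize a + q.eval (csize a))) e3
  simp only [Polynomial.eval_add, Polynomial.eval_mul, Polynomial.eval_comp, Polynomial.eval_X]
  omega

theorem PTime.foldl [Inhabited β] {l : α → List β} {c : α → γ} {g : α → γ → β → γ}
    (hl : PTime l) (hc : PTime c) (hg : PTime fun p : α × γ × β => g p.1 p.2.1 p.2.2)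
    (p : Polynomial ℕ) (h : ∀ a x b, csize (g a x b) ≤ csize x + p.eval (csize a + csize b)) :
    PTime fun a => (l a).foldl (g a) (c a) :=
  PTime.foldl_of_measure hl hc hg csize .X .X p (by simp) (by simp) h

@[fun_prop] theorem PTime.reverse [Inhabited β] {l : α → List β} (hl : PTime l) :
    PTime fun a => (l a).reverse := by
  refine (PTime.foldl (c := fun _ => []) (g := fun _ x b => b :: x) hl (.const _) (by fun_prop)
    (.X + 1) fun a x b => ?_).congr fun a => by simp [← List.foldr_reverse]
  simp; omega

@[fun_prop] theorem PTime.append [Inhabited β] {l l' : α → List β} (hl : PTime l)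
    (hl' : PTime l') : PTime fun a => l a ++ l' a := by
  refine (PTime.foldl (l := fun a => (l a).reverse) (c := l') (g := fun _ x b => b :: x)
    (by fun_prop) hl' (by fun_prop) (.X + 1) fun a x b => ?_).congr fun a => by simp
  simp; omega

@[fun_prop] theorem PTime.map [Inhabited β] [Inhabited γ] {l : α → List β} {f : α → β → γ}
    (hl : PTime l) (hf : PTime fun p : α × β => f p.1 p.2) : PTime fun a => (l a).map (f a) := by
  obtain ⟨q, hq⟩ := hf.csize_le
  have hg : PTime fun p : α × List γ × β => f p.1 p.2.2 :=
    hf.comp (f := fun p : α × List γ × β => (p.1, p.2.2)) (by fun_prop)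
  have h := PTime.foldl (c := fun _ => []) (g := fun a x b => f a b :: x) hl (.const _)
    (hg.cons (by fun_prop)) (q.comp (.X + 1) + 1) fun a x b => ?_
  · refine h.reverse.congr fun a => ?_
    have : ∀ (l : List β) (x : List γ), l.foldl (fun x b => f a b :: x) x =
        (l.map (f a)).reverse ++ x := by
      intro l
      induction l with
      | nil => simp
      | cons b l ih => intro x; simp [ih]
    simp [this]
  · have := hq (a, b)
    rw [csize_mk] at this
    dsimp only at this
    simp only [csize_cons, Polynomial.eval_add, Polynomial.eval_comp, Polynomial.eval_X,
      Polynomial.eval_one]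
    omega

/-! ### Natural numbers in unary -/

/-- The datum of a natural number: a list of that length. -/
def encNat : ℕ → Data
  | 0 => .nil
  | n + 1 => .cons .nil (encNat n)

/-- Unary is affordable for indices, scores and round numbers, which are polynomial in the number of
candidates. It makes arithmetic plain iteration. The weights need the separate binary type `Bin`. -/
instance : Code ℕ := ⟨encNat⟩

@[simp] theorem csize_nat (n : ℕ) : csize n = 2 * n + 1 := by
  induction n with
  | zero => rfl
  | succ n ih =>
    have : csize (n + 1) = 1 + csize n + 1 := Data.size_cons _ _
    omega

@[simp] theorem len_enc_nat (n : ℕ) : (enc n).len = n := by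
  induction n with
  | zero => rfl
  | succ n ih => exact congrArg (· + 1) ih

theorem PTime.succ {f : α → ℕ} (hf : PTime f) : PTime fun a => f a + 1 :=
  ((PTime.const ()).prodMk hf : PTime fun a => ((), f a))

theorem PTime.pred {f : α → ℕ} (hf : PTime f) : PTime fun a => f a - 1 := by
  refine PTime.of_enc ((PTime.dataSnd.comp hf.enc).congr fun a => ?_)
  cases f a <;> rfl

@[fun_prop] theorem PTime.decide_eq_zero {f : α → ℕ} (hf : PTime f) :
    PTime fun a => decide (f a = 0) :=
  (PTime.ite_isNil hf.enc (.const true) (.const false)).congr fun a => by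
    cases h : f a <;> simp [Code.enc, encNat, Data.isNil]

theorem PTime.iterate {f : α → β → β} {n : α → ℕ} {b : α → β}
    (hf : PTime fun p : α × β => f p.1 p.2) (hn : PTime n) (hb : PTime b)
    (hB : ∃ q : Polynomial ℕ, ∀ a, ∀ k ≤ n a, csize ((f a)^[k] (b a)) ≤ q.eval (csize a)) :
    PTime fun a => (f a)^[n a] (b a) := by
  obtain ⟨q, hq⟩ := hB
  have key : ∀ (a : α) (b : β) (k : ℕ),
      (fun p : α × β => (p.1, f p.1 p.2))^[k] (a, b) = (a, (f a)^[k] b) := by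
    intro a b k
    induction k generalizing b with
    | zero => rfl
    | succ k ih => rw [iterate_succ_apply, ih, ← iterate_succ_apply]
  have h := PTime.iterate_len (f := fun p : α × β => (p.1, f p.1 p.2)) (b := fun a => (a, b a))
    (by fun_prop) hn.enc (by fun_prop) ⟨.X + q + 1, fun a k hk => ?_⟩
  · exact h.snd.congr fun a => by rw [len_enc_nat, key]
  · rw [len_enc_nat] at hk
    have := hq a k hk
    rw [key, csize_mk]
    simp only [Polynomial.eval_add, Polynomial.eval_X, Polynomial.eval_one]
    omega

@[fun_prop] theorem PTime.add {f g : α → ℕ} (hf : PTime f) (hg : PTime g) :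
    PTime fun a => f a + g a := by
  obtain ⟨q, hq⟩ := hf.csize_le
  obtain ⟨q', hq'⟩ := hg.csize_le
  have key : ∀ k m : ℕ, (fun x : ℕ => x + 1)^[k] m = m + k := fun k m => by simp
  refine (PTime.iterate (f := fun _ x => x + 1) (PTime.succ (by fun_prop)) hg hf
    ⟨q + 2 * q', fun a k hk => ?_⟩).congr fun a => key _ _
  have e1 := hq a
  have e2 := hq' a
  rw [key]
  simp only [csize_nat, Polynomial.eval_add, Polynomial.eval_mul, Polynomial.eval_ofNat] at *
  omega

@[fun_prop] theorem PTime.sub {f g : α → ℕ} (hf : PTime f) (hg : PTime g) :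
    PTime fun a => f a - g a := by
  obtain ⟨q, hq⟩ := hf.csize_le
  have key : ∀ k m : ℕ, (fun x : ℕ => x - 1)^[k] m = m - k := fun k => by
    induction k with
    | zero => simp
    | succ k ih => intro m; rw [iterate_succ_apply, ih]; omega
  refine (PTime.iterate (f := fun _ x => x - 1) (PTime.pred (by fun_prop)) hg hf
    ⟨q, fun a k hk => ?_⟩).congr fun a => key _ _
  have e1 := hq a
  rw [key]
  simp only [csize_nat] at *
  omega

@[fun_prop] theorem PTime.mul {f g : α → ℕ} (hf : PTime f) (hg : PTime g) :
    PTime fun a => f a * g a := by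
  obtain ⟨q, hq⟩ := hf.csize_le
  obtain ⟨q', hq'⟩ := hg.csize_le
  have key : ∀ d k m : ℕ, (fun x : ℕ => x + d)^[k] m = m + k * d := fun d k => by
    induction k with
    | zero => simp
    | succ k ih => intro m; rw [iterate_succ_apply, ih]; ring
  have hs : PTime fun p : α × ℕ => p.2 + g p.1 := by
    exact PTime.add (by fun_prop) (hg.comp (f := fun p : α × ℕ => p.1) (by fun_prop))
  refine (PTime.iterate (f := fun a x => x + g a) hs hf (.const 0)
    ⟨2 * (q * q') + 1, fun a k hk => ?_⟩).congr fun a => by rw [key]; simp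
  have e1 := hq a
  have e2 := hq' a
  rw [key]
  simp only [csize_nat, Polynomial.eval_add, Polynomial.eval_mul, Polynomial.eval_ofNat,
    Polynomial.eval_one, zero_add] at *
  have : k * g a ≤ q.eval (csize a) * q'.eval (csize a) := Nat.mul_le_mul (by omega) (by omega)
  omega

@[fun_prop] theorem PTime.decide_le {f g : α → ℕ} (hf : PTime f) (hg : PTime g) :
    PTime fun a => decide (f a ≤ g a) :=
  (hf.sub hg).decide_eq_zero.congr fun a => by simp [Nat.sub_eq_zero_iff_le]

@[fun_prop] theorem PTime.decide_lt {f g : α → ℕ} (hf : PTime f) (hg : PTime g) :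
    PTime fun a => decide (f a < g a) :=
  (hg.decide_le hf).decide_not.congr fun a => by simp

@[fun_prop] theorem PTime.decide_nat_eq {f g : α → ℕ} (hf : PTime f) (hg : PTime g) :
    PTime fun a => decide (f a = g a) :=
  ((hf.decide_le hg).decide_and (hg.decide_le hf)).congr fun a => by simp [le_antisymm_iff]

@[fun_prop] theorem PTime.length {l : α → List β} (hl : PTime l) :
    PTime fun a => (l a).length := by
  obtain ⟨q, hq⟩ := hl.csize_le
  have key : ∀ k m : ℕ, (fun x : ℕ => x + 1)^[k] m = m + k := fun k m => by simp
  refine (PTime.iterate_length (f := fun x : ℕ => x + 1) (PTime.succ PTime.id) hl (.const 0)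
    ⟨2 * q + 1, fun a k hk => ?_⟩).congr fun a => by rw [key]; simp
  have e1 := (length_le_csize _).trans (hq a)
  rw [key]
  simp only [csize_nat, Polynomial.eval_add, Polynomial.eval_mul, Polynomial.eval_ofNat,
    Polynomial.eval_one]
  omega

@[fun_prop] theorem PTime.drop {l : α → List β} {n : α → ℕ} (hl : PTime l) (hn : PTime n) :
    PTime fun a => (l a).drop (n a) := by
  obtain ⟨q, hq⟩ := hl.csize_le
  have key : ∀ (k : ℕ) (l : List β), (fun x : List β => x.tail)^[k] l = l.drop k := fun k => by
    induction k with
    | zero => simp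
    | succ k ih => intro l; rw [iterate_succ_apply, ih]; simp
  refine (PTime.iterate (f := fun _ x => x.tail) (by fun_prop) hn hl
    ⟨q, fun a k hk => ?_⟩).congr fun a => key _ _
  rw [key]
  exact (csize_drop_le _ _).trans (hq a)

@[fun_prop] theorem PTime.getD {l : α → List β} {n : α → ℕ} {d : α → β} (hl : PTime l)
    (hn : PTime n) (hd : PTime d) : PTime fun a => (l a).getD (n a) (d a) :=
  ((hl.drop hn).headD hd).congr fun a => by
    rw [List.headD_eq_head?_getD, List.head?_drop, List.getD_eq_getElem?_getD]

@[fun_prop] theorem PTime.range {n : α → ℕ} (hn : PTime n) : PTime fun a => List.range (n a) := by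
  obtain ⟨q, hq⟩ := hn.csize_le
  have key : ∀ k m : ℕ, (fun x : List ℕ => x ++ [x.length])^[k] (List.range m) =
      List.range (m + k) := fun k => by
    induction k with
    | zero => simp
    | succ k ih =>
      intro m
      rw [iterate_succ_apply, List.length_range, ← List.range_succ, ih]
      congr 1; omega
  refine (PTime.iterate (f := fun _ x => x ++ [x.length]) (by fun_prop) hn (.const (List.range 0))
    ⟨q * (2 * q + 2) + 1, fun a k hk => ?_⟩).congr fun a => (key _ 0).trans (by simp)
  have e1 := hq a
  simp only [csize_nat] at e1
  rw [key, zero_add]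
  refine (csize_list_le (B := 2 * q.eval (csize a) + 1) fun x hx => ?_).trans ?_
  · have := List.mem_range.1 hx
    simp only [csize_nat]
    omega
  · simp only [List.length_range, Polynomial.eval_add, Polynomial.eval_mul, Polynomial.eval_ofNat,
      Polynomial.eval_one]
    exact Nat.add_le_add_right (Nat.mul_le_mul (by omega) (by omega)) 1

@[fun_prop] theorem PTime.sum {l : α → List ℕ} (hl : PTime l) : PTime fun a => (l a).sum := by
  refine (PTime.foldl (c := fun _ => 0) (g := fun _ x b => x + b) hl (.const _) (by fun_prop)
    .X fun a x b => ?_).congr fun a => (List.sum_eq_foldl ..).symm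
  simp; omega

@[fun_prop] theorem PTime.all [Inhabited β] {l : α → List β} {f : α → β → Bool} (hl : PTime l)
    (hf : PTime fun p : α × β => f p.1 p.2) : PTime fun a => (l a).all (f a) := by
  have h1 : PTime fun a => ((l a).map (f a)).foldl (fun x b => if b = true then x else false) true :=
    PTime.foldl (g := fun _ x b => if b = true then x else false) (by fun_prop) (.const _)
      (by fun_prop) (.C 3) fun a x b => by
        have := csize_bool_le (if b = true then x else false)
        simp only [Polynomial.eval_C]; omega
  refine h1.congr fun a => ?_
  have : ∀ (l : List Bool) (x : Bool), l.foldl (fun x b => if b = true then x else false) x =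
      (x && l.all fun b => b) := by
    intro l
    induction l with
    | nil => simp
    | cons b l ih => intro x; rw [List.foldl_cons, ih]; cases b <;> simp
  rw [this]
  simp [List.all_map, Function.comp_def]

end StackProgram

end

section

open Function Computability

set_option linter.unusedSimpArgs false

namespace StackProgram

open Code

variable {α β γ δ : Type} [Code α] [Code β] [Code γ] [Code δ]

/-! ### Symbols -/

/-- The number of a symbol. -/
def symbolIndex : Γ' → ℕ
  | .blank => 0
  | .bit false => 1
  | .bit true => 2
  | .bra => 3
  | .ket => 4
  | .comma => 5

instance : Code Γ' := ⟨fun x => enc (symbolIndex x)⟩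

theorem csize_symbol_le (x : Γ') : csize x ≤ 11 := by
  change csize (symbolIndex x) ≤ 11
  rw [csize_nat]
  rcases x with _ | (_ | _) | _ | _ | _ <;> simp [symbolIndex]

theorem PTime.symbol_cases {x : α → Γ'} {f : Γ' → α → β} (hx : PTime x)
    (hf : ∀ y, PTime (f y)) : PTime fun a => f (x a) a := by
  have hx' : PTime fun a => symbolIndex (x a) := hx
  have h := fun y => hf y
  refine (PTime.ite (P := fun a => symbolIndex (x a) = 0) (by fun_prop) (hf .blank) <|
    PTime.ite (P := fun a => symbolIndex (x a) = 1) (by fun_prop) (hf (.bit false)) <|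
    PTime.ite (P := fun a => symbolIndex (x a) = 2) (by fun_prop) (hf (.bit true)) <|
    PTime.ite (P := fun a => symbolIndex (x a) = 3) (by fun_prop) (hf .bra) <|
    PTime.ite (P := fun a => symbolIndex (x a) = 4) (by fun_prop) (hf .ket) (hf .comma)).congr
      fun a => ?_
  rcases x a with _ | (_ | _) | _ | _ | _ <;> simp [symbolIndex]

/-! ### Natural numbers in binary -/

/-- Natural numbers that are represented in binary. -/
@[ext] structure Bin where
  /-- The value. -/
  val : ℕ

instance : Inhabited Bin := ⟨⟨0⟩⟩

instance : Code Bin := ⟨fun n => enc (Nat.bits n.val)⟩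

theorem csize_bin (n : Bin) : csize n = csize (Nat.bits n.val) := rfl

theorem csize_listBool_le (l : List Bool) : csize l ≤ 4 * l.length + 1 := by
  have := csize_list_le (l := l) (B := 3) fun x _ => csize_bool_le x
  omega

theorem csize_bin_le (n : Bin) : csize n ≤ 4 * Nat.size n.val + 1 := by
  have := csize_listBool_le (Nat.bits n.val)
  rwa [Nat.size_eq_bits_len, ← csize_bin] at this

theorem size_le_csize_bin (n : Bin) : Nat.size n.val ≤ csize n := by
  rw [← Nat.size_eq_bits_len]
  exact length_le_csize _

theorem csize_bin_le_of_le {m n : Bin} (h : m.val ≤ n.val) : csize m ≤ 4 * csize n + 1 := by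
  have h1 := csize_bin_le m
  have h2 := size_le_csize_bin n
  have h3 := Nat.size_le_size h
  omega

/-- The last bit. -/
def Bin.bodd (n : Bin) : Bool := n.val.bodd

/-- The number without its last bit. -/
def Bin.div2 (n : Bin) : Bin := ⟨n.val.div2⟩

/-- Append a bit. -/
def Bin.bit (b : Bool) (n : Bin) : Bin := ⟨Nat.bit b n.val⟩

@[fun_prop] theorem PTime.binBodd {f : α → Bin} (hf : PTime f) : PTime fun a => (f a).bodd := by
  have hf' : PTime fun a => Nat.bits (f a).val := hf
  refine (hf'.headD (.const false)).congr fun a => ?_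
  rw [Bin.bodd, List.headD_eq_head?_getD]
  induction (f a).val using Nat.binaryRec' with
  | zero => simp
  | bit b n h _ => rw [Nat.bits_append_bit _ _ h]; simp

@[fun_prop] theorem PTime.binDiv2 {f : α → Bin} (hf : PTime f) : PTime fun a => (f a).div2 := by
  have hf' : PTime fun a => Nat.bits (f a).val := hf
  refine PTime.of_enc (hf'.tail.enc.congr fun a => ?_)
  change Code.enc _ = Code.enc (Nat.bits (f a).val.div2)
  congr 1
  induction (f a).val using Nat.binaryRec' with
  | zero => simp
  | bit b n h _ => rw [Nat.bits_append_bit _ _ h, Nat.div2_bit]; rfl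

@[fun_prop] theorem PTime.decide_bin_eq_zero {f : α → Bin} (hf : PTime f) :
    PTime fun a => decide ((f a).val = 0) := by
  have hf' : PTime fun a => Nat.bits (f a).val := hf
  refine hf'.decide_eq_nil.decide_congr fun a => ?_
  rw [← List.length_eq_zero_iff, Nat.size_eq_bits_len, Nat.size_eq_zero]

@[fun_prop] theorem PTime.binBit {b : α → Bool} {f : α → Bin} (hb : PTime b) (hf : PTime f) :
    PTime fun a => Bin.bit (b a) (f a) := by
  have hf' : PTime fun a => Nat.bits (f a).val := hf
  -- The code has no leading zeros, so appending the bit `false` to zero must give the empty list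
  -- again.
  have h : PTime fun a => if (f a).val = 0 ∧ ¬ b a = true then [] else b a :: Nat.bits (f a).val := by
    fun_prop
  refine PTime.of_enc (h.enc.congr fun a => ?_)
  change Code.enc _ = Code.enc (Nat.bits (Nat.bit _ _))
  congr 1
  split_ifs with h
  · rw [h.1]; simp [h.2]
  · rw [Nat.bits_append_bit]
    intro h0
    simpa [h0] using h

/-- The number with the given bits, most significant bit first. -/
def Bin.ofBits (l : List Bool) : Bin := l.foldl (fun n b => Bin.bit b n) ⟨0⟩

theorem Bin.foldl_bit_val (l : List Bool) (n : Bin) :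
    (l.foldl (fun n b => Bin.bit b n) n).val = n.val * 2 ^ l.length + (Bin.ofBits l).val := by
  induction l generalizing n with
  | nil => simp [Bin.ofBits]
  | cons b l ih =>
    rw [Bin.ofBits, List.foldl_cons, List.foldl_cons, ih, ih (Bin.bit b ⟨0⟩)]
    simp only [Bin.bit, Nat.bit_val, List.length_cons, pow_succ]
    ring

theorem Bin.val_ofBits_cons (b : Bool) (l : List Bool) :
    (Bin.ofBits (b :: l)).val = b.toNat * 2 ^ l.length + (Bin.ofBits l).val := by
  rw [Bin.ofBits, List.foldl_cons, Bin.foldl_bit_val]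
  simp [Bin.bit, Nat.bit_val]

theorem Bin.val_ofBits_lt (l : List Bool) : (Bin.ofBits l).val < 2 ^ l.length := by
  induction l with
  | nil => simp [Bin.ofBits]
  | cons b l ih =>
    rw [Bin.val_ofBits_cons, List.length_cons, pow_succ]
    cases b <;> simp <;> omega

theorem Bin.ofBits_reverse_bits (n : ℕ) : Bin.ofBits (Nat.bits n).reverse = ⟨n⟩ := by
  rw [Bin.ofBits, List.foldl_reverse]
  induction n using Nat.binaryRec' with
  | zero => simp
  | bit b n h ih => rw [Nat.bits_append_bit _ _ h, List.foldr_cons, ih]; rfl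

theorem csize_ofBits_le (l : List Bool) : csize (Bin.ofBits l) ≤ 4 * l.length + 1 := by
  have h1 := csize_bin_le (Bin.ofBits l)
  have h2 := Nat.size_le.2 (Bin.val_ofBits_lt l)
  omega

@[fun_prop] theorem PTime.ofBits {l : α → List Bool} (hl : PTime l) :
    PTime fun a => Bin.ofBits (l a) := by
  obtain ⟨q, hq⟩ := hl.csize_le
  change PTime fun a => (l a).foldl (fun n b => Bin.bit b n) ⟨0⟩
  refine PTime.foldl_of_prefix (c := fun _ => ⟨0⟩) (g := fun _ n b => Bin.bit b n) hl (.const _)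
    (by fun_prop) ⟨4 * q + 1, fun a l' h => ?_⟩
  have h1 := csize_ofBits_le l'
  have h2 := h.length_le
  have h3 := (length_le_csize _).trans (hq a)
  simp only [Polynomial.eval_add, Polynomial.eval_mul, Polynomial.eval_ofNat, Polynomial.eval_one]
  exact h1.trans (by omega)

/-! #### Addition -/

instance : Add Bin := ⟨fun m n => ⟨m.val + n.val⟩⟩

@[simp] theorem Bin.val_add (m n : Bin) : (m + n).val = m.val + n.val := rfl

/-- One step of binary addition, on the numbers that remain to be added, the carry, and the bits of
the result. -/
def addStep (s : Bin × Bin × Bool × List Bool) : Bin × Bin × Bool × List Bool :=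
  (s.1.div2, s.2.1.div2,
    if s.1.bodd = true then
      (if s.2.1.bodd = true then true else s.2.2.1)
    else (if s.2.1.bodd = true then s.2.2.1 else false),
    (if s.1.bodd = true then
      (if s.2.1.bodd = true then s.2.2.1 else if s.2.2.1 = true then false else true)
    else (if s.2.1.bodd = true then if s.2.2.1 = true then false else true else s.2.2.1))
      :: s.2.2.2)

/-- The invariant of schoolbook addition: what remains to be added, with the carry, shifted by the
number of bits already produced, plus the value of those bits. The result bits are consed, hence
most significant first, as `Bin.ofBits` expects. -/
theorem iterate_addStep (k : ℕ) (m n : Bin) (c : Bool) (l : List Bool) :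
    let s := addStep^[k] (m, n, c, l)
    (s.1.val + s.2.1.val + s.2.2.1.toNat) * 2 ^ s.2.2.2.length + (Bin.ofBits s.2.2.2).val =
      (m.val + n.val + c.toNat) * 2 ^ l.length + (Bin.ofBits l).val ∧
    s.1.val ≤ m.val ∧ s.2.1.val ≤ n.val ∧ s.2.2.2.length = l.length + k := by
  induction k generalizing m n c l with
  | zero => simp
  | succ k ih =>
    rw [iterate_succ_apply]
    obtain ⟨h1, h2, h3, h4⟩ := ih (addStep (m, n, c, l)).1 (addStep (m, n, c, l)).2.1
      (addStep (m, n, c, l)).2.2.1 (addStep (m, n, c, l)).2.2.2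
    refine ⟨h1.trans ?_, h2.trans ?_, h3.trans ?_, h4.trans ?_⟩
    · have e1 := Nat.bodd_add_div2 m.val
      have e2 := Nat.bodd_add_div2 n.val
      simp only [addStep, Bin.val_ofBits_cons, List.length_cons, pow_succ, Bin.div2, Bin.bodd]
      generalize 2 ^ l.length = P
      rcases Bool.eq_false_or_eq_true m.val.bodd with h | h <;>
        rcases Bool.eq_false_or_eq_true n.val.bodd with h' | h' <;> cases c <;>
        simp [h, h'] at e1 e2 ⊢ <;> generalize m.val.div2 = x at * <;>
        generalize n.val.div2 = y at * <;> rw [← e1, ← e2] <;> ring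
    · simp [addStep, Bin.div2, Nat.div2_val]; omega
    · simp [addStep, Bin.div2, Nat.div2_val]; omega
    · simp [addStep]; omega

theorem PTime.binAdd_aux : PTime fun p : Bin × Bin => p.1 + p.2 := by
  -- This list only fixes the number of rounds. The additional element provides a round for the last
  -- carry.
  have hN : PTime fun p : Bin × Bin => true :: (Nat.bits p.1.val ++ Nat.bits p.2.val) := by
    have h1 : PTime fun p : Bin × Bin => Nat.bits p.1.val := PTime.fst PTime.id
    have h2 : PTime fun p : Bin × Bin => Nat.bits p.2.val := PTime.snd PTime.id
    fun_prop
  have hs : PTime addStep := by unfold addStep; fun_prop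
  have h := PTime.iterate_length (b := fun p : Bin × Bin => (p.1, p.2, false, ([] : List Bool)))
    hs hN (by fun_prop) ⟨16 * .X + 20, fun p k hk => ?_⟩
  · refine h.snd.snd.snd.ofBits.congr fun p => ?_
    obtain ⟨h1, h2, h3, h4⟩ := iterate_addStep
      (true :: (Nat.bits p.1.val ++ Nat.bits p.2.val)).length p.1 p.2 false []
    generalize addStep^[_] (p.1, p.2, false, []) = s at *
    ext
    simp only [Bin.ofBits, List.foldl_nil, List.length_nil, Bool.toNat_false] at h1
    rw [Bin.val_add]
    have h5 : p.1.val < 2 ^ p.1.val.size := Nat.lt_size_self _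
    have h6 : p.2.val < 2 ^ p.2.val.size := Nat.lt_size_self _
    have h7 : s.2.2.2.length = p.1.val.size + p.2.val.size + 1 := by
      simp [h4, Nat.size_eq_bits_len]
    have h8 : 2 ^ p.1.val.size ≤ 2 ^ (p.1.val.size + p.2.val.size) :=
      Nat.pow_le_pow_right (by norm_num) (by omega)
    have h9 : 2 ^ p.2.val.size ≤ 2 ^ (p.1.val.size + p.2.val.size) :=
      Nat.pow_le_pow_right (by norm_num) (by omega)
    rw [h7, pow_succ] at h1
    -- If something were left over, the invariant would make the sum at least two to the number of
    -- rounds, which exceeds it.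
    rcases Nat.eq_zero_or_pos (s.1.val + s.2.1.val + s.2.2.1.toNat) with h0 | h0
    · rw [h0] at h1
      simpa [Bin.ofBits] using h1
    · have := Nat.mul_le_mul_right (2 ^ (p.1.val.size + p.2.val.size) * 2) h0
      omega
  · obtain ⟨-, h2, h3, h4⟩ := iterate_addStep k p.1 p.2 false []
    generalize addStep^[_] (p.1, p.2, false, []) = s at *
    obtain ⟨s1, s2, s3, s4⟩ := s
    simp only at h2 h3 h4
    have e1 := csize_bin_le_of_le h2
    have e2 := csize_bin_le_of_le h3
    have e3 := csize_bool_le s3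
    have e4 := csize_listBool_le s4
    have e5 := size_le_csize_bin p.1
    have e6 := size_le_csize_bin p.2
    have e7 : csize p = csize p.1 + csize p.2 + 1 := csize_mk p.1 p.2
    simp only [List.length_cons, List.length_append, Nat.size_eq_bits_len, List.length_nil]
      at hk h4
    simp only [csize_mk, Polynomial.eval_add, Polynomial.eval_mul, Polynomial.eval_ofNat,
      Polynomial.eval_X]
    omega

@[fun_prop] theorem PTime.binAdd {f g : α → Bin} (hf : PTime f) (hg : PTime g) :
    PTime fun a => f a + g a := PTime.binAdd_aux.comp (hf.prodMk hg)

/-! #### Comparison -/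

/-- One step of the comparison of two numbers, from the last bits on. -/
def ltStep (s : Bin × Bin × Bool) : Bin × Bin × Bool :=
  (s.1.div2, s.2.1.div2,
    if s.1.bodd = true then (if s.2.1.bodd = true then s.2.2 else false)
    else (if s.2.1.bodd = true then true else s.2.2))

/-- The flag holds the verdict on the bits already removed and counts only if the remaining numbers
agree. A differing bit overrides it, because later bits are more significant. Once both numbers are
used up, the flag alone is the answer. -/
theorem iterate_ltStep (k : ℕ) (m n : Bin) (c : Bool) :
    let s := ltStep^[k] (m, n, c)
    (s.1.val < s.2.1.val ∨ s.1.val = s.2.1.val ∧ s.2.2 = true ↔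
      m.val < n.val ∨ m.val = n.val ∧ c = true) ∧
    s.1.val = m.val / 2 ^ k ∧ s.2.1.val = n.val / 2 ^ k := by
  induction k generalizing m n c with
  | zero => simp
  | succ k ih =>
    rw [iterate_succ_apply]
    obtain ⟨h1, h2, h3⟩ := ih (ltStep (m, n, c)).1 (ltStep (m, n, c)).2.1 (ltStep (m, n, c)).2.2
    refine ⟨h1.trans ?_, h2.trans ?_, h3.trans ?_⟩
    · have e1 := Nat.bodd_add_div2 m.val
      have e2 := Nat.bodd_add_div2 n.val
      simp only [ltStep, Bin.div2, Bin.bodd]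
      rcases Bool.eq_false_or_eq_true m.val.bodd with h | h <;>
        rcases Bool.eq_false_or_eq_true n.val.bodd with h' | h' <;> cases c <;>
        simp [h, h'] at e1 e2 ⊢ <;> omega
    · simp [ltStep, Bin.div2, Nat.div2_val, Nat.div_div_eq_div_mul, pow_succ, mul_comm]
    · simp [ltStep, Bin.div2, Nat.div2_val, Nat.div_div_eq_div_mul, pow_succ, mul_comm]

theorem PTime.decide_binLt_aux : PTime fun p : Bin × Bin => decide (p.1.val < p.2.val) := by
  have hN : PTime fun p : Bin × Bin => Nat.bits p.1.val ++ Nat.bits p.2.val := by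
    have h1 : PTime fun p : Bin × Bin => Nat.bits p.1.val := PTime.fst PTime.id
    have h2 : PTime fun p : Bin × Bin => Nat.bits p.2.val := PTime.snd PTime.id
    fun_prop
  have hs : PTime ltStep := by unfold ltStep; fun_prop
  have h := PTime.iterate_length (b := fun p : Bin × Bin => (p.1, p.2, false))
    hs hN (by fun_prop) ⟨4 * .X + 20, fun p k hk => ?_⟩
  · refine h.snd.snd.congr fun p => ?_
    obtain ⟨h1, h2, h3⟩ := iterate_ltStep
      (Nat.bits p.1.val ++ Nat.bits p.2.val).length p.1 p.2 false
    have h7 : (Nat.bits p.1.val ++ Nat.bits p.2.val).length = p.1.val.size + p.2.val.size := by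
      simp [Nat.size_eq_bits_len]
    have h5 : p.1.val < 2 ^ p.1.val.size := Nat.lt_size_self _
    have h6 : p.2.val < 2 ^ p.2.val.size := Nat.lt_size_self _
    have h8 : 2 ^ p.1.val.size ≤ 2 ^ (p.1.val.size + p.2.val.size) :=
      Nat.pow_le_pow_right (by norm_num) (by omega)
    have h9 : 2 ^ p.2.val.size ≤ 2 ^ (p.1.val.size + p.2.val.size) :=
      Nat.pow_le_pow_right (by norm_num) (by omega)
    generalize ltStep^[_] (p.1, p.2, false) = s at *
    rw [h7, Nat.div_eq_of_lt (by omega)] at h2 h3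
    rw [h2, h3] at h1
    simp at h1
    rw [Bool.eq_iff_iff, h1, decide_eq_true_iff]
  · obtain ⟨-, h2, h3⟩ := iterate_ltStep k p.1 p.2 false
    generalize ltStep^[_] (p.1, p.2, false) = s at *
    obtain ⟨s1, s2, s3⟩ := s
    simp only at h2 h3
    have e1 := csize_bin_le_of_le (h2.le.trans (Nat.div_le_self _ _))
    have e2 := csize_bin_le_of_le (h3.le.trans (Nat.div_le_self _ _))
    have e3 := csize_bool_le s3
    have e7 : csize p = csize p.1 + csize p.2 + 1 := csize_mk p.1 p.2
    simp only [csize_mk, Polynomial.eval_add, Polynomial.eval_mul, Polynomial.eval_ofNat,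
      Polynomial.eval_X]
    omega

@[fun_prop] theorem PTime.decide_binLt {f g : α → Bin} (hf : PTime f) (hg : PTime g) :
    PTime fun a => decide ((f a).val < (g a).val) := PTime.decide_binLt_aux.comp (hf.prodMk hg)

theorem size_add_le (m n : ℕ) : Nat.size (m + n) ≤ Nat.size m + (Nat.size n + 1) := by
  rw [Nat.size_le]
  have h1 := Nat.lt_size_self m
  have h2 := Nat.lt_size_self n
  have h3 : 2 ^ Nat.size m ≤ 2 ^ (Nat.size m + Nat.size n) :=
    Nat.pow_le_pow_right (by norm_num) (by omega)
  have h4 : 2 ^ Nat.size n ≤ 2 ^ (Nat.size m + Nat.size n) :=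
    Nat.pow_le_pow_right (by norm_num) (by omega)
  rw [← add_assoc, pow_succ]
  omega

/-- Sums of numbers that are selected from a list. -/
theorem PTime.binSum [Inhabited β] {l : α → List β} {f : α → β → Bin} (hl : PTime l)
    (hf : PTime fun p : α × β => f p.1 p.2) :
    PTime fun a => (l a).foldl (fun n b => n + f a b) ⟨0⟩ := by
  obtain ⟨q, hq⟩ := hf.csize_le
  have hg : PTime fun p : α × Bin × β => f p.1 p.2.2 :=
    hf.comp (f := fun p : α × Bin × β => (p.1, p.2.2)) (by fun_prop)
  refine PTime.foldl_of_measure (g := fun a n b => n + f a b) hl (.const _)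
    (PTime.binAdd (by fun_prop) hg)
    (fun n => Nat.size n.val) (4 * .X + 1) .X (q.comp (.X + 1) + 1)
    (fun n => by simpa using csize_bin_le n) (fun n => by simpa using size_le_csize_bin n)
    fun a n b => ?_
  have e1 := size_add_le n.val (f a b).val
  have e2 := (size_le_csize_bin (f a b)).trans (hq (a, b))
  rw [csize_mk] at e2
  simp only [Bin.val_add, Polynomial.eval_add, Polynomial.eval_comp, Polynomial.eval_X,
    Polynomial.eval_one]
  omega

end StackProgram

end

section

open Function Computability

set_option linter.unusedSimpArgs false

namespace StackProgram

open Code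

/-! ### Decision problems -/

/-- Put the representation of the word on the stack `r + 1` in front of the list on the stack `r`,
in reverse order. -/
def encodeLoop (r : ℕ) : Cmd :=
  .popWhile (r + 1) fun x => pushWord r (.bit true :: ctext x)

theorem run_encodeLoop (s : Store) (r : ℕ) (l l' : List Γ') :
    Run (encodeLoop r) (put s r (ctext l') l [] []) (put s r (ctext (l.reverse ++ l')) [] [] [])
      (26 * l.length + 1) := by
  induction l generalizing l' with
  | nil => exact (Run.popWhile_nil (put_one ..)).congr (by simp) (by simp)
  | cons x l ih =>
    have h := run_pushWord (put s r (ctext l') l [] []) r (.bit true :: ctext x)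
    have h1 : Γ'.bit true :: ctext x ++ ctext l' = ctext (x :: l') := rfl
    rw [put_zero, update_put_zero, h1] at h
    have h2 := csize_symbol_le x
    refine (Run.popWhile_cons (T := 25) (put_one ..) ?_ (ih (x :: l'))).congr (by simp) ?_
    · rw [update_put_one]
      refine h.congr rfl ?_
      simp only [List.length_cons, length_ctext]
      omega
    · simp only [List.length_cons]
      omega

/-- The program for a decision problem, given a program that works on representations. -/
def decisionCmd (c : ℕ → Cmd) (r : ℕ) : Cmd :=
  moveRev r (r + 1) ;; .push r (.bit false) ;; encodeLoop r ;; c r ;;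
    .popCase r .skip fun x => clear r ;; .push r x

theorem csize_word_le (l : List Γ') : csize l ≤ 12 * l.length + 1 := by
  have := csize_list_le (l := l) (B := 11) fun x _ => csize_symbol_le x
  omega

theorem PTime.nonempty_computableInPolyTime {α : Type} (encode : α → List Γ') {f : List Γ' → Bool}
    (hf : PTime f) :
    Nonempty (Turing.TM2ComputableInPolyTime encode encodeBool fun a => f (encode a)) := by
  obtain ⟨c, p, h⟩ := hf
  refine StackProgram.nonempty_computableInPolyTime encode _ (decisionCmd c 0)
    (28 * .X + p.comp (12 * .X + 1) + 20) fun a => ?_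
  have hput : ∀ l : List Γ', update (fun _ => []) 0 l = put (fun _ => []) 0 l [] [] [] := by
    intro l
    funext j
    simp [put, update_apply]
  rw [hput, hput]
  have h1 := run_moveRev (s := put (fun _ => []) 0 (encode a) [] [] []) (a := 0) (b := 0 + 1)
    (by omega) (put_zero ..)
  have h2 := Run.push 0 (.bit false) (put (fun _ => []) 0 [] (encode a).reverse [] [])
  have h3 := run_encodeLoop (fun _ => []) 0 (encode a).reverse []
  have h4 := h 0 (fun _ => []) (encode a)
  simp only [update_put_zero, update_put_one, put_zero, put_one, List.append_nil,
    List.reverse_reverse] at h1 h2 h3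
  have h5 : Run (.popCase 0 .skip fun x => clear 0 ;; .push 0 x)
      (put (fun _ => []) 0 (ctext (f (encode a))) [] [] [])
      (put (fun _ => []) 0 [.bit (f (encode a))] [] [] []) 10 := by
    -- The codes of the truth values begin with the symbol for the truth value itself, so the top of
    -- the stack is the answer and at most two symbols must be cleared.
    have e1 : ∃ l, l.length ≤ 2 ∧ ctext (f (encode a)) = .bit (f (encode a)) :: l := by
      cases f (encode a)
      · exact ⟨[], by simp, rfl⟩
      · exact ⟨[.bit false, .bit false], by simp, rfl⟩
    obtain ⟨l, hl, e1⟩ := e1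
    rw [e1]
    have e2 : Run (clear 0) (put (fun _ => []) 0 l [] [] []) (put (fun _ => []) 0 [] [] [] []) 5 :=
      (run_clear (put_zero ..)).congr (by simp) (by omega)
    have e3 := e2.seq (Run.push 0 (.bit (f (encode a))) _)
    rw [put_zero, update_put_zero] at e3
    refine (Run.popCase_cons (T := 7) (put_zero ..) ?_).congr rfl (by omega)
    rw [update_put_zero]
    exact e3
  obtain ⟨t, ht, hex⟩ := h1.seq (h2.seq (h3.seq (h4.seq h5)))
  refine ⟨t, ht.trans ?_, hex⟩
  have e1 := eval_le_eval p (csize_word_le (encode a))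
  simp only [List.length_reverse, Polynomial.eval_add, Polynomial.eval_mul, Polynomial.eval_comp,
    Polynomial.eval_ofNat, Polynomial.eval_X, Polynomial.eval_one]
  omega

theorem PTime.inP {α : Type} {encode : α → List Γ'} {Q : α → Prop} {f : List Γ' → Bool}
    (hf : PTime f) (h : ∀ a, f (encode a) = true ↔ Q a) : InP encode Q :=
  ⟨fun a => f (encode a), h, hf.nonempty_computableInPolyTime encode⟩

end StackProgram

end

/-! ### The combinatorial core: balancing as a test for bounded orientations. -/

section

open Finset

namespace Balancing

/-! ### Distributing points by balancing -/

variable {ι : Type} [Fintype ι] (free forced : ι → ι → Prop) [DecidableRel free]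
  [DecidableRel forced]

/-- The points that `i` receives for the pair `{i, j}`, given the points so far: the two points of a
free pair go to the side that has less, and are shared if both have the same. -/
def gain (y : ι → ℕ) (i j : ι) : ℕ :=
  if free i j then (if y i < y j then 2 else if y i = y j then 1 else 0)
  else if forced i j then 2 else 0

/-- The points after `k` rounds. -/
def points : ℕ → ι → ℕ
  | 0, _ => 0
  | k + 1, i => points k i + ∑ j, gain free forced (points k) i j

variable {free forced}

theorem gain_le {ι : Type} {free forced : ι → ι → Prop} [DecidableRel free]
    [DecidableRel forced] (y : ι → ℕ) (i j : ι) : gain free forced y i j ≤ 2 := by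
  unfold gain
  split_ifs <;> omega

theorem gain_add_gain {ι : Type} {free forced : ι → ι → Prop} [DecidableRel free]
    [DecidableRel forced] (hsymm : ∀ i j, free i j → free j i) (y : ι → ℕ) {i j : ι} (h : free i j) :
    gain free forced y i j + gain free forced y j i = 2 := by
  simp only [gain, if_pos h, if_pos (hsymm _ _ h)]
  split_ifs <;> omega

theorem sum_gain_le (y : ι → ℕ) (i : ι) :
    ∑ j, gain free forced y i j ≤ 2 * Fintype.card ι := by
  refine (sum_le_card_nsmul univ _ 2 fun j _ => gain_le y i j).trans ?_
  simp [mul_comm]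

/-! #### If the points can be distributed, balancing nearly succeeds -/

section
variable {s : Finset ι} {g : ι → ι → ℕ} {c : ℤ} (hsymm : ∀ i j, free i j → free j i)
  (hs : ∀ i j, free i j → i ∈ s) (hfree : ∀ i j, free i j → 2 ≤ g i j + g j i)
  (hforced : ∀ i j, forced i j → 2 ≤ g i j) (hg : ∀ i ∈ s, ∑ j, (g i j : ℤ) ≤ c)
include hsymm hs hfree hforced hg

/-- Here `g` is a hypothetical solution with row sums at most `c`, and `u` is a weight that grows
with the points. On a free pair the greedy rule gives both points to an end of least weight, so its
weighted cost is at most that of `g`; on forced pairs `g` gives at least as much. Summing over pairs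
compares the greedy rule with `g`, hence with `c`. -/
theorem sum_mul_gain_le (y : ι → ℕ) (u : ι → ℤ) (hu : ∀ i, 0 ≤ u i)
    (huy : ∀ i j, y i ≤ y j → u i ≤ u j) :
    ∑ i ∈ s, u i * ((∑ j, gain free forced y i j : ℕ) - c) ≤ 0 := by
  classical
  let h : ι → ι → ℤ := fun i j =>
    if i ∈ s then u i * ((gain free forced y i j : ℤ) - g i j) else 0
  have hle : ∀ i j, ¬ free i j → h i j ≤ 0 := by
    intro i j hij
    simp only [h, gain, if_neg hij]
    split_ifs with h1 h2
    · have := hforced i j h2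
      have := hu i
      push_cast
      nlinarith
    · have := hu i
      push_cast
      nlinarith
    · exact le_rfl
  have hh : ∀ i j, h i j + h j i ≤ 0 := by
    intro i j
    by_cases hij : free i j
    · have hji := hsymm _ _ hij
      have e1 : (2 : ℤ) ≤ g i j + g j i := by exact_mod_cast hfree i j hij
      have e2 := hu i
      have e3 := hu j
      have e4 : (0 : ℤ) ≤ g i j := by positivity
      have e5 : (0 : ℤ) ≤ g j i := by positivity
      simp only [h, if_pos (hs i j hij), if_pos (hs j i hji), gain, if_pos hij, if_pos hji]
      rcases lt_trichotomy (y i) (y j) with hlt | heq | hlt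
      · have e6 := huy i j hlt.le
        simp only [if_pos hlt, if_neg hlt.not_gt, if_neg hlt.ne']
        push_cast
        nlinarith [mul_nonneg e5 (sub_nonneg.2 e6), mul_nonneg e2 (sub_nonneg.2 e1)]
      · have e6 := le_antisymm (huy i j heq.le) (huy j i heq.ge)
        simp only [heq, lt_irrefl, if_false, if_true]
        push_cast
        rw [e6]
        nlinarith [mul_nonneg e3 (sub_nonneg.2 e1)]
      · have e6 := huy j i hlt.le
        simp only [if_pos hlt, if_neg hlt.not_gt, if_neg hlt.ne']
        push_cast
        nlinarith [mul_nonneg e4 (sub_nonneg.2 e6), mul_nonneg e3 (sub_nonneg.2 e1)]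
    · exact add_nonpos (hle i j hij) (hle j i fun hji => hij (hsymm _ _ hji))
  -- A single `h i j` may be positive on a free pair; only the two orders of a pair together are
  -- controlled, so the double sum is symmetrized.
  have hsum : ∑ i, ∑ j, h i j ≤ 0 := by
    have h1 : ∑ i, ∑ j, (h i j + h j i) ≤ 0 :=
      sum_nonpos fun i _ => sum_nonpos fun j _ => hh i j
    simp only [sum_add_distrib] at h1
    rw [sum_comm (f := fun i j => h j i)] at h1
    omega
  calc ∑ i ∈ s, u i * ((∑ j, gain free forced y i j : ℕ) - c)
      ≤ ∑ i ∈ s, u i * ((∑ j, gain free forced y i j : ℕ) - ∑ j, (g i j : ℤ)) :=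
        sum_le_sum fun i hi => mul_le_mul_of_nonneg_left (by have := hg i hi; omega) (hu i)
    _ = ∑ i ∈ s, ∑ j, u i * ((gain free forced y i j : ℤ) - g i j) := by
        refine sum_congr rfl fun i _ => ?_
        push_cast
        rw [← sum_sub_distrib, mul_sum]
    _ = ∑ i, ∑ j, h i j := by
        rw [← sum_filter_add_sum_filter_not univ (· ∈ s)]
        simp only [h]
        rw [sum_eq_zero (s := filter (fun x => ¬ x ∈ s) univ), add_zero]
        · simp only [filter_mem_eq_inter, univ_inter]
          exact sum_congr rfl fun i hi => sum_congr rfl fun j _ => by rw [if_pos hi]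
        · intro i hi
          exact sum_eq_zero fun j _ => if_neg (mem_filter.1 hi).2
    _ ≤ 0 := hsum

/-- The potential is the sum of the squared positive excesses. Expanding the square, the cross term
is nonpositive by `sum_mul_gain_le` with the excess as weight. The remaining term is at most `(2 *
n) ^ 2` for each of at most `n` elements. -/
theorem sum_sq_points_le (hc : c ≤ 2 * Fintype.card ι) (k : ℕ) :
    ∑ i ∈ s, (max 0 ((points free forced k i : ℤ) - k * c)) ^ 2 ≤
      4 * k * (Fintype.card ι : ℤ) ^ 3 := by
  induction k with
  | zero => simp [points]
  | succ k ih =>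
    have h1 := sum_mul_gain_le hsymm hs hfree hforced hg (points free forced k)
      (fun i => max 0 ((points free forced k i : ℤ) - k * c)) (fun i => le_max_left _ _)
      (fun i j hij => max_le_max le_rfl (by
        have : (points free forced k i : ℤ) ≤ points free forced k j := by exact_mod_cast hij
        omega))
    have h2 : ∀ i ∈ s, (max 0 ((points free forced (k + 1) i : ℤ) - (k + 1 : ℕ) * c)) ^ 2 ≤
        (max 0 ((points free forced k i : ℤ) - k * c)) ^ 2 +
        2 * (max 0 ((points free forced k i : ℤ) - k * c) *
          ((∑ j, gain free forced (points free forced k) i j : ℕ) - c)) +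
        4 * (Fintype.card ι : ℤ) ^ 2 := by
      intro i hi
      have e1 : ((∑ j, gain free forced (points free forced k) i j : ℕ) : ℤ) ≤
          2 * Fintype.card ι := by exact_mod_cast sum_gain_le _ i
      have e2 : 0 ≤ c := (sum_nonneg fun j _ => by positivity).trans (hg i hi)
      have e3 : ((points free forced (k + 1) i : ℕ) : ℤ) = points free forced k i +
          (∑ j, gain free forced (points free forced k) i j : ℕ) := by
        rw [points]; push_cast; rfl
      have e4 : (0 : ℤ) ≤ (∑ j, gain free forced (points free forced k) i j : ℕ) := by positivity
      rw [e3]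
      generalize ((∑ j, gain free forced (points free forced k) i j : ℕ) : ℤ) = G at *
      generalize (points free forced k i : ℤ) = y at *
      -- Both `G` and `c` lie between `0` and `2 * n`.
      have e5 : (G - c) ^ 2 ≤ 4 * (Fintype.card ι : ℤ) ^ 2 := by
        have := sq_le_sq' (a := G - c) (b := 2 * (Fintype.card ι : ℤ)) (by linarith) (by linarith)
        linarith
      -- Truncating the excess before adding the new difference does not decrease the square of the
      -- truncated result.
      have e6 : (max 0 (y + G - (k + 1 : ℕ) * c)) ^ 2 ≤ (max 0 (y - k * c) + (G - c)) ^ 2 := by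
        rcases le_total 0 (y + G - (k + 1 : ℕ) * c) with h | h
        · rw [max_eq_right h]
          refine pow_le_pow_left₀ h ?_ 2
          have := le_max_right 0 (y - k * c)
          push_cast
          linarith
        · rw [max_eq_left h]
          positivity
      nlinarith
    calc _ ≤ _ := sum_le_sum h2
      _ = ∑ i ∈ s, (max 0 ((points free forced k i : ℤ) - k * c)) ^ 2 +
          2 * ∑ i ∈ s, (max 0 ((points free forced k i : ℤ) - k * c) *
            ((∑ j, gain free forced (points free forced k) i j : ℕ) - c)) +
          #s * (4 * (Fintype.card ι : ℤ) ^ 2) := by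
        rw [sum_add_distrib, sum_add_distrib, mul_sum]
        simp
      _ ≤ 4 * k * (Fintype.card ι : ℤ) ^ 3 + 2 * 0 +
          Fintype.card ι * (4 * (Fintype.card ι : ℤ) ^ 2) := by
        gcongr
        exact s.card_le_univ
      _ = _ := by push_cast; ring

theorem points_lt (hc : c ≤ 2 * Fintype.card ι) (k t : ℕ)
    (hkt : 4 * k * Fintype.card ι ^ 3 < t ^ 2) {i : ι} (hi : i ∈ s) :
    (points free forced k i : ℤ) < k * c + t := by
  by_contra! hlt
  have h1 := sum_sq_points_le hsymm hs hfree hforced hg hc k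
  have h2 := single_le_sum (f := fun i => (max 0 ((points free forced k i : ℤ) - k * c)) ^ 2)
    (fun i _ => by positivity) hi
  have h3 : (t : ℤ) ^ 2 ≤ (max 0 ((points free forced k i : ℤ) - k * c)) ^ 2 :=
    pow_le_pow_left₀ (by positivity) (le_max_of_le_right (by linarith)) 2
  have h4 : (4 * k * (Fintype.card ι : ℤ) ^ 3) < (t : ℤ) ^ 2 := by exact_mod_cast hkt
  linarith

end

/-! #### If balancing nearly succeeds, no set is overloaded -/

/-- The two points of a free pair inside `r` stay in `r` no matter who gets them. The filter counts
ordered pairs, so each such pair contributes two, as it should. -/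
theorem le_sum_gain (hsymm : ∀ i j, free i j → free j i) (hdisj : ∀ i j, forced i j → ¬ free i j)
    (y : ι → ℕ) (r : Finset ι) :
    #{e ∈ r ×ˢ r | free e.1 e.2} + 2 * ∑ i ∈ r, #{j | forced i j} ≤
      ∑ i ∈ r, ∑ j, gain free forced y i j := by
  classical
  have h1 : ∀ i, ∑ j, gain free forced y i j = (∑ j with free i j, gain free forced y i j) +
      2 * #{j | forced i j} := by
    intro i
    rw [← sum_filter_add_sum_filter_not univ (free i), sum_filter (s := univ) (p := fun x => ¬ _),
      mul_comm, ← smul_eq_mul, ← sum_const, sum_filter (p := forced i)]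
    congr 1
    refine sum_congr rfl fun j _ => ?_
    by_cases h : free i j
    · have h' : ¬ forced i j := fun h' => hdisj _ _ h' h
      simp [h, h']
    · simp [gain, h]
  have h2 : #{e ∈ r ×ˢ r | free e.1 e.2} = ∑ i ∈ r, ∑ j ∈ r with free i j, gain free forced y i j := by
    have e1 : ∑ i ∈ r, ∑ j ∈ r with free i j, gain free forced y i j =
        ∑ e ∈ r ×ˢ r with free e.1 e.2, gain free forced y e.1 e.2 := by
      rw [sum_filter, sum_product]
      exact sum_congr rfl fun i _ => sum_filter _ _
    have e2 : ∑ e ∈ r ×ˢ r with free e.1 e.2, gain free forced y e.1 e.2 =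
        ∑ e ∈ r ×ˢ r with free e.1 e.2, gain free forced y e.2 e.1 := by
      refine sum_bij' (fun e _ => e.swap) (fun e _ => e.swap) ?_ ?_ ?_ ?_ ?_
      · rintro ⟨i, j⟩ h
        simp only [mem_filter, mem_product, Prod.swap_prod_mk] at h ⊢
        exact ⟨h.1.symm, hsymm _ _ h.2⟩
      · rintro ⟨i, j⟩ h
        simp only [mem_filter, mem_product, Prod.swap_prod_mk] at h ⊢
        exact ⟨h.1.symm, hsymm _ _ h.2⟩
      · simp
      · simp
      · simp
    have e3 : ∑ e ∈ r ×ˢ r with free e.1 e.2,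
        (gain free forced y e.1 e.2 + gain free forced y e.2 e.1) =
        ∑ e ∈ r ×ˢ r with free e.1 e.2, 2 :=
      sum_congr rfl fun e he => gain_add_gain hsymm y (mem_filter.1 he).2
    rw [sum_add_distrib, ← e2, sum_const, smul_eq_mul] at e3
    rw [e1]
    omega
  rw [h2]
  simp only [h1, sum_add_distrib, ← mul_sum]
  gcongr
  exact subset_univ _

theorem le_sum_points (hsymm : ∀ i j, free i j → free j i)
    (hdisj : ∀ i j, forced i j → ¬ free i j) (k : ℕ) (r : Finset ι) :
    k * (#{e ∈ r ×ˢ r | free e.1 e.2} + 2 * ∑ i ∈ r, #{j | forced i j}) ≤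
      ∑ i ∈ r, points free forced k i := by
  induction k with
  | zero => simp
  | succ k ih =>
    have := le_sum_gain hsymm hdisj (points free forced k) r
    simp only [points, sum_add_distrib, add_mul, one_mul]
    omega

/-- Over `k` rounds the set `r` collects `k` times its demand, yet less than `k * (2 * #r * d) + #r
* t` in total. Since `#r * t ≤ k`, the demand is below `2 * #r * d + 1`, and both sides are
integers. -/
theorem card_free_add_le (hsymm : ∀ i j, free i j → free j i)
    (hdisj : ∀ i j, forced i j → ¬ free i j) {k t : ℕ} {d : ℤ} {s : Finset ι}
    (hkt : Fintype.card ι * t ≤ k)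
    (h : ∀ i ∈ s, (points free forced k i : ℤ) < k * (2 * d) + t) {r : Finset ι} (hr : r ⊆ s) :
    (#{e ∈ r ×ˢ r | free e.1 e.2} : ℤ) + 2 * ∑ i ∈ r, (#{j | forced i j} : ℤ) ≤ 2 * (#r * d) := by
  rcases r.eq_empty_or_nonempty with rfl | hne
  · simp
  have h1 := le_sum_points hsymm hdisj k r
  have h2 : (∑ i ∈ r, points free forced k i : ℤ) < ∑ i ∈ r, (k * (2 * d) + (t : ℤ)) :=
    sum_lt_sum_of_nonempty hne fun i hi => h i (hr hi)
  rw [sum_const, nsmul_eq_mul] at h2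
  have h3 : #r * t ≤ k := (Nat.mul_le_mul_right t r.card_le_univ).trans hkt
  have h3' : (#r * t : ℤ) ≤ k := by exact_mod_cast h3
  have h1' : (k : ℤ) * (#{e ∈ r ×ˢ r | free e.1 e.2} + 2 * ∑ i ∈ r, (#{j | forced i j} : ℤ)) ≤
      ∑ i ∈ r, (points free forced k i : ℤ) := by exact_mod_cast h1
  by_contra! hlt
  have h4 : (0 : ℤ) ≤ k := by positivity
  nlinarith

/-! #### If no set is overloaded, the points can be distributed -/

/-- Hall's marriage theorem: each free pair must choose a slot at one of its ends, where the vertex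
`i` offers `d` slots less one for each forced point. A set of pairs with set of ends `r` sees all
slots of `r`, and the hypothesis for `r` is exactly Hall's condition. -/
theorem exists_orientation [LinearOrder ι] (hsymm : ∀ i j, free i j → free j i)
    (hirr : ∀ i, ¬ free i i) {s : Finset ι} (hs : ∀ i j, free i j → i ∈ s) {d : ℤ}
    (h : ∀ r ⊆ s, (#{e ∈ r ×ˢ r | free e.1 e.2} : ℤ) + 2 * ∑ i ∈ r, (#{j | forced i j} : ℤ) ≤
      2 * (#r * d)) :
    ∃ win : ι → ι → Prop, (∀ i j, free i j → win i j ∨ win j i) ∧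
      (∀ i j, win i j → ¬ win j i) ∧
      ∀ i ∈ s, ∀ a : Finset ι, (∀ j ∈ a, win i j ∨ forced i j) → (#a : ℤ) ≤ d := by
  classical
  let f : ι → ℕ := fun i => #{j | forced i j}
  -- Singletons show that the forced points alone fit, so the `toNat` below loses nothing.
  have hf : ∀ i ∈ s, (f i : ℤ) ≤ d := by
    intro i hi
    have := h {i} (by simpa using hi)
    simp only [sum_singleton, card_singleton] at this
    simp only [f]
    push_cast at this
    omega
  let k : ι → ℕ := fun i => (d - f i).toNat
  -- The linear order picks one representative of each unordered pair.
  let E := {e : ι × ι // e.1 < e.2 ∧ free e.1 e.2}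
  let t : E → Finset (Σ _ : ι, ℕ) := fun e =>
    ({e.1.1, e.1.2} : Finset ι).sigma fun i => range (k i)
  have hall : ∀ A : Finset E, #A ≤ #(A.biUnion t) := by
    intro A
    let r : Finset ι := A.biUnion fun e => {e.1.1, e.1.2}
    have hr : r ⊆ s := by
      intro i hi
      simp only [r, mem_biUnion, mem_insert, mem_singleton] at hi
      obtain ⟨e, -, rfl | rfl⟩ := hi
      · exact hs _ _ e.2.2
      · exact hs _ _ (hsymm _ _ e.2.2)
    have h1 : r.sigma (fun i => range (k i)) ⊆ A.biUnion t := by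
      rintro ⟨i, x⟩ hx
      simp only [mem_sigma, r, mem_biUnion] at hx
      obtain ⟨⟨e, he, hi⟩, hx⟩ := hx
      exact mem_biUnion.2 ⟨e, he, mem_sigma.2 ⟨hi, hx⟩⟩
    have h2 : 2 * #A ≤ #{e ∈ r ×ˢ r | free e.1 e.2} := by
      have e1 : #(A.image Subtype.val) = #A := card_image_of_injective _ Subtype.val_injective
      have e2 : #((A.image Subtype.val).image Prod.swap) = #A := by
        rw [card_image_of_injective _ Prod.swap_injective, e1]
      have e3 : Disjoint (A.image Subtype.val) ((A.image Subtype.val).image Prod.swap) := by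
        rw [disjoint_left]
        rintro ⟨i, j⟩ hx hy
        simp only [mem_image, Prod.exists, Prod.swap_prod_mk, Prod.mk.injEq] at hx hy
        obtain ⟨e, -, he⟩ := hx
        obtain ⟨i', j', ⟨e', -, he'⟩, rfl, rfl⟩ := hy
        have l1 := e.2.1
        have l2 := e'.2.1
        rw [he] at l1
        rw [he'] at l2
        exact lt_asymm l1 l2
      have e4 : A.image Subtype.val ∪ (A.image Subtype.val).image Prod.swap ⊆
          {e ∈ r ×ˢ r | free e.1 e.2} := by
        have hmem : ∀ e ∈ A, e.1.1 ∈ r ∧ e.1.2 ∈ r := fun e he =>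
          ⟨mem_biUnion.2 ⟨e, he, by simp⟩, mem_biUnion.2 ⟨e, he, by simp⟩⟩
        intro x hx
        rcases mem_union.1 hx with hx | hx
        · obtain ⟨e, he, rfl⟩ := mem_image.1 hx
          exact mem_filter.2 ⟨mem_product.2 (hmem e he), e.2.2⟩
        · obtain ⟨_, hy, rfl⟩ := mem_image.1 hx
          obtain ⟨e, he, rfl⟩ := mem_image.1 hy
          exact mem_filter.2 ⟨mem_product.2 (hmem e he).symm, hsymm _ _ e.2.2⟩
      have e5 := card_le_card e4
      rw [card_union_of_disjoint e3, e1, e2] at e5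
      omega
    have h3 : (#(r.sigma fun i => range (k i)) : ℤ) = #r * d - ∑ i ∈ r, (f i : ℤ) := by
      rw [card_sigma]
      push_cast
      rw [← nsmul_eq_mul, ← sum_const, ← sum_sub_distrib]
      refine sum_congr rfl fun i hi => ?_
      have := hf i (hr hi)
      simp only [card_range, k]
      omega
    have h4 := h r hr
    have h5 := card_le_card h1
    have h2' : (2 * #A : ℤ) ≤ #{e ∈ r ×ˢ r | free e.1 e.2} := by exact_mod_cast h2
    simp only [f] at h3
    omega
  obtain ⟨m, hm, hmt⟩ := (all_card_le_biUnion_card_iff_exists_injective t).1 hall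
  have hmt' : ∀ e, (m e).1 = e.1.1 ∨ (m e).1 = e.1.2 := fun e => by
    simpa using (mem_sigma.1 (hmt e)).1
  refine ⟨fun i j => ∃ e : E, (e.1 = (i, j) ∨ e.1 = (j, i)) ∧ (m e).1 = i, ?_, ?_, ?_⟩
  · intro i j hij
    rcases lt_trichotomy i j with hlt | rfl | hlt
    · rcases hmt' ⟨(i, j), hlt, hij⟩ with h1 | h1
      · exact Or.inl ⟨_, Or.inl rfl, h1⟩
      · exact Or.inr ⟨_, Or.inr rfl, h1⟩
    · exact absurd hij (hirr i)
    · rcases hmt' ⟨(j, i), hlt, hsymm _ _ hij⟩ with h1 | h1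
      · exact Or.inr ⟨_, Or.inl rfl, h1⟩
      · exact Or.inl ⟨_, Or.inr rfl, h1⟩
  · rintro i j ⟨e, he, h1⟩ ⟨e', he', h1'⟩
    have hlt := e.2.1
    have hlt' := e'.2.1
    have hee : e = e' := by
      apply Subtype.ext
      rcases he with he | he <;> rcases he' with he' | he' <;> rw [he, he'] <;>
        rw [he] at hlt <;> rw [he'] at hlt' <;> simp only at hlt hlt' <;>
        exact absurd hlt' (lt_asymm hlt)
    subst hee
    rw [h1] at h1'
    subst h1'
    rcases he with he | he <;> rw [he] at hlt <;> exact lt_irrefl _ hlt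
  · intro i hi a ha
    have h1 : #{j ∈ a | ¬ forced i j} ≤ k i := by
      have h2 : ∀ j ∈ filter (fun j => ¬ forced i j) a,
          ∃ e : E, (e.1 = (i, j) ∨ e.1 = (j, i)) ∧ (m e).1 = i := by
        intro j hj
        obtain ⟨h3, h4⟩ := mem_filter.1 hj
        exact (ha j h3).resolve_right h4
      rcases (filter (fun j => ¬ forced i j) a).eq_empty_or_nonempty with h0 | ⟨j₀, hj₀⟩
      · rw [h0]
        exact Nat.zero_le _
      have : Nonempty E := ⟨(h2 j₀ hj₀).choose⟩
      choose! e he1 he2 using h2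
      -- Won pairs occupy distinct slots of `i`: an equal slot means an equal pair, and the pair
      -- together with its end `i` determines the opponent.
      have h3 := card_le_card_of_injOn (s := filter (fun j => ¬ forced i j) a) (t := range (k i))
        (fun j => (m (e j)).2) ?_ ?_
      · simpa using h3
      · intro j hj
        have h4 := (mem_sigma.1 (hmt (e j))).2
        rwa [he2 j hj] at h4
      · intro j hj j' hj' hjj
        have h4 : m (e j) = m (e j') :=
          Sigma.ext ((he2 j hj).trans (he2 j' hj').symm) (heq_of_eq hjj)
        have h5 := hm h4
        have l1 := he1 j hj
        have l2 := he1 j' hj'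
        have l3 := (e j').2.1
        rw [h5] at l1
        rcases l1 with l1 | l1 <;> rcases l2 with l2 | l2 <;> rw [l1] at l2 l3 <;>
          simp only [Prod.mk.injEq] at l2 l3
        · exact l2.2
        · exact l2.2.trans l2.1
        · exact l2.1.trans l2.2
        · exact l2.1
    have h2 : #{j ∈ a | forced i j} ≤ f i := card_le_card (filter_subset_filter _ (subset_univ _))
    have h3 : #{j ∈ a | forced i j} + #{j ∈ a | ¬ forced i j} = #a := by
      convert card_filter_add_card_filter_not (s := a) (forced i)
    have h4 := hf i hi
    simp only [k] at h1
    omega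

end Balancing

end

/-! ### From manipulation to balancing. -/

section

open Finset

namespace Election

open Balancing

/-! ### Elections with a coalition of manipulators -/

variable {m : ℕ}

theorem support_append (V W : Profile m) (a b : Fin m) :
    support (V ++ W) a b = support V a b + support W a b := by
  simp [support]

theorem support_add_support_le (W : Profile m) (a b : Fin m) :
    support W a b + support W b a ≤ (W.map fun v => (v.1 : ℕ)).sum := by
  induction W with
  | nil => simp [support]
  | cons v W ih =>
    have h : (if v.2.prefers a b = true then (v.1 : ℕ) else 0) +
        (if v.2.prefers b a = true then (v.1 : ℕ) else 0) ≤ v.1 := by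
      split_ifs with h1 h2
      · rw [v.2.asymm a b h1] at h2
        simp at h2
      all_goals simp
    simp only [support, List.map_cons, List.sum_cons] at *
    omega

theorem support_map_same (v : PairwiseVote m) (L : List ℕ+) (a b : Fin m) :
    support (L.map fun n => (n, v)) a b =
      if v.prefers a b = true then (L.map fun n : ℕ+ => (n : ℕ)).sum else 0 := by
  induction L with
  | nil => simp [support]
  | cons n L ih =>
    simp only [support, List.map_cons, List.sum_cons] at *
    rw [ih]
    split_ifs <;> simp

/-- The Llull score. -/
def llullScore (V : Profile m) (a : Fin m) : ℕ := #{b | b ≠ a ∧ support V b a ≤ support V a b}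

theorem copelandScore_one (V : Profile m) (a : Fin m) :
    copelandScore 1 V a = llullScore V a := by
  unfold copelandScore llullScore
  rw [card_filter, Nat.cast_sum, ← sum_erase_add univ _ (mem_univ a)]
  simp only [ne_eq, not_true_eq_false, false_and, if_false, Nat.cast_zero, add_zero]
  refine sum_congr rfl fun b hb => ?_
  rw [mem_erase] at hb
  rcases lt_trichotomy (support V b a) (support V a b) with h | h | h
  · simp [h, h.le, hb.1]
  · simp [h, hb.1]
  · simp [h.not_gt, h.ne, h.not_ge]

/-- The coalition of total weight `S` can make `a` defeat `b`. -/
def CanDefeat (V : Profile m) (S : ℕ) (a b : Fin m) : Prop := support V b a < support V a b + S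

/-- The coalition of total weight `S` can choose the winner between `a` and `b`. -/
def IsFree (V : Profile m) (S : ℕ) (p a b : Fin m) : Prop :=
  a ≠ b ∧ a ≠ p ∧ b ≠ p ∧ CanDefeat V S a b ∧ CanDefeat V S b a

/-- The candidate `a` gets a point against `b` no matter what the coalition of total weight `S`
does, as long as it votes for `p`. -/
def IsForced (V : Profile m) (S : ℕ) (p a b : Fin m) : Prop :=
  a ≠ b ∧ a ≠ p ∧ ¬ CanDefeat V S b a

instance (V : Profile m) (S : ℕ) : DecidableRel (CanDefeat V S) := fun _ _ =>
  inferInstanceAs (Decidable (_ < _))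

instance (V : Profile m) (S : ℕ) (p : Fin m) : DecidableRel (IsFree V S p) := fun _ _ =>
  inferInstanceAs (Decidable (_ ∧ _))

instance (V : Profile m) (S : ℕ) (p : Fin m) : DecidableRel (IsForced V S p) := fun _ _ =>
  inferInstanceAs (Decidable (_ ∧ _))

theorem IsFree.symm {V : Profile m} {S : ℕ} {p a b : Fin m} (h : IsFree V S p a b) :
    IsFree V S p b a := ⟨h.1.symm, h.2.2.1, h.2.1, h.2.2.2.2, h.2.2.2.1⟩

theorem IsForced.not_isFree {V : Profile m} {S : ℕ} {p a b : Fin m} (h : IsForced V S p a b) :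
    ¬ IsFree V S p a b := by
  exact fun h' => h.2.2 h'.2.2.2.2

/-- The score of `p` if a coalition of total weight `S` votes for `p`. -/
def bestScore (V : Profile m) (S : ℕ) (p : Fin m) : ℕ :=
  #{b | b ≠ p ∧ support V b p ≤ support V p b + S}

/-- The score that the candidates other than `p` may have at most. -/
def scoreBound (V : Profile m) (S : ℕ) (p : Fin m) : WinnerModel → ℤ
  | .nonunique => bestScore V S p
  | .unique => bestScore V S p - 1

/-- This puts both winner models in the form of an upper bound for the rivals. The bound is an
integer because in the unique-winner model it can be `-1`. -/
theorem isLlullWinner_iff (V : Profile m) (p : Fin m) (w : WinnerModel) :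
    IsLlullWinner V p w ↔ ∀ a, a ≠ p → (llullScore V a : ℤ) ≤
      match w with
      | .nonunique => (llullScore V p : ℤ)
      | .unique => llullScore V p - 1 := by
  cases w
  · simp only [IsLlullWinner, copelandScore_one]
    constructor
    · intro h a _
      exact_mod_cast h a
    · intro h a
      by_cases ha : a = p
      · rw [ha]
      · exact_mod_cast h a ha
  · simp only [IsLlullWinner, copelandScore_one]
    refine forall₂_congr fun a _ => ?_
    rw [Int.le_sub_one_iff]
    norm_cast

theorem bestScore_le (V : Profile m) (S : ℕ) (p : Fin m) : bestScore V S p ≤ m :=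
  (card_le_univ _).trans (Fintype.card_fin m).le

/-- If the coalition can make `p` win, balancing nearly succeeds. -/
theorem points_lt_of_isLlullWinner (V W : Profile m) (S : ℕ) (p : Fin m) (w : WinnerModel)
    (hS : (W.map fun v => (v.1 : ℕ)).sum = S) (h : IsLlullWinner (V ++ W) p w) (k t : ℕ)
    (hkt : 4 * k * m ^ 3 < t ^ 2) {a : Fin m} (ha : a ≠ p) :
    (points (IsFree V S p) (IsForced V S p) k a : ℤ) < k * (2 * scoreBound V S p w) + t := by
  classical
  have hle := fun a b => support_add_support_le W a b
  rw [hS] at hle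
  have happ := support_append V W
  refine points_lt (s := univ.erase p)
    -- The solution to compare with is read off from the winning election: two for every Llull
    -- point. A tie gives both sides a point, so a free pair contributes at least two.
    (g := fun a b => if b ≠ a ∧ support (V ++ W) b a ≤ support (V ++ W) a b then 2 else 0)
    (fun a b h => h.symm) (fun a b h => mem_erase.2 ⟨h.2.1, mem_univ _⟩) ?_ ?_ ?_ ?_ k t
    (by simpa using hkt) (mem_erase.2 ⟨ha, mem_univ _⟩)
  · intro a b hab
    rcases le_total (support (V ++ W) b a) (support (V ++ W) a b) with h1 | h1
    · simp [h1, hab.1.symm]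
    · simp [h1, hab.1]
  · rintro a b ⟨h1, h2, h3⟩
    have h4 := hle a b
    have h5 := hle b a
    suffices h6 : support (V ++ W) b a ≤ support (V ++ W) a b from (if_pos ⟨h1.symm, h6⟩).ge
    rw [happ, happ]
    rw [CanDefeat] at h3
    omega
  · intro a ha
    have h1 := (isLlullWinner_iff _ _ _).1 h a (mem_erase.1 ha).1
    -- No votes of the coalition serve `p` better than unanimous support.
    have h2 : llullScore (V ++ W) p ≤ bestScore V S p := by
      refine card_le_card fun b hb => ?_
      simp only [mem_filter, mem_univ, true_and, happ] at hb ⊢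
      have h4 := hle p b
      exact ⟨hb.1, by omega⟩
    have h3 : ∑ b, (((if b ≠ a ∧ support (V ++ W) b a ≤ support (V ++ W) a b then 2 else 0 : ℕ)) : ℤ)
        = 2 * llullScore (V ++ W) a := by
      rw [llullScore, card_filter]
      push_cast
      rw [mul_sum]
      exact sum_congr rfl fun b _ => by split_ifs <;> simp
    rw [h3]
    cases w <;> simp only [scoreBound] at h1 ⊢ <;> omega
  · have := bestScore_le V S p
    rw [Fintype.card_fin]
    cases w <;> simp only [scoreBound] <;> omega

open Classical in
/-- If balancing nearly succeeds, the coalition can make `p` win. -/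
theorem exists_isLlullWinner (V : Profile m) (L : List ℕ+) (S : ℕ) (p : Fin m) (w : WinnerModel)
    (tm : TieModel) (hS : (L.map fun n : ℕ+ => (n : ℕ)).sum = S) (k t : ℕ) (hkt : m * t ≤ k)
    (h : ∀ a ≠ p, (points (IsFree V S p) (IsForced V S p) k a : ℤ) <
      k * (2 * scoreBound V S p w) + t) :
    ∃ W : Profile m, W.map Prod.fst = L ∧ (∀ v ∈ W, v.2.IsAllowed tm) ∧
      IsLlullWinner (V ++ W) p w := by
  obtain ⟨win, h1, h2, h3⟩ := exists_orientation (free := IsFree V S p) (forced := IsForced V S p)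
    (s := univ.erase p) (d := scoreBound V S p w) (fun a b h => h.symm) (fun a h => h.1 rfl)
    (fun a b h => mem_erase.2 ⟨h.2.1, mem_univ _⟩) fun r hr =>
      card_free_add_le (fun a b h => h.symm) (fun a b h => h.not_isFree)
        (by simpa using hkt) (fun a ha => h a (mem_erase.1 ha).1) hr
  -- This is the common vote of all manipulators: `p` beats everyone, free pairs follow the
  -- orientation, and otherwise the side that can be made to defeat the other is preferred. If
  -- neither can, the order of the indices decides, merely to avoid a tie in the vote. Being
  -- asymmetric and total, the vote is allowed in both tie models.
  let P : Fin m → Fin m → Prop := fun a b => a ≠ b ∧ (a = p ∨ b ≠ p ∧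
    if IsFree V S p a b then win a b
    else CanDefeat V S a b ∨ ¬ CanDefeat V S b a ∧ a < b)
  have hasymm : ∀ a b, P a b → ¬ P b a := by
    rintro a b ⟨e1, e2⟩ ⟨-, e3⟩
    by_cases ha : a = p
    · subst ha
      rcases e3 with e3 | e3
      · exact e1 e3.symm
      · exact e3.1 rfl
    by_cases hb : b = p
    · subst hb
      rcases e2 with e2 | e2
      · exact e1 e2
      · exact e2.1 rfl
    replace e2 := (e2.resolve_left ha).2
    replace e3 := (e3.resolve_left hb).2
    by_cases hf : IsFree V S p a b
    · rw [if_pos hf] at e2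
      rw [if_pos hf.symm] at e3
      exact h2 _ _ e2 e3
    · rw [if_neg hf] at e2
      rw [if_neg fun h => hf h.symm] at e3
      have hn : ¬ (CanDefeat V S a b ∧ CanDefeat V S b a) := fun h => hf ⟨e1, ha, hb, h⟩
      rcases e2 with e2 | e2 <;> rcases e3 with e3 | e3
      · exact hn ⟨e2, e3⟩
      · exact e3.1 e2
      · exact e2.1 e3
      · exact lt_asymm e2.2 e3.2
  have htotal : ∀ a b, a ≠ b → P a b ∨ P b a := by
    intro a b hab
    by_cases ha : a = p
    · exact Or.inl ⟨hab, Or.inl ha⟩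
    by_cases hb : b = p
    · exact Or.inr ⟨hab.symm, Or.inl hb⟩
    by_cases hf : IsFree V S p a b
    · rcases h1 a b hf with h | h
      · exact Or.inl ⟨hab, Or.inr ⟨hb, by rwa [if_pos hf]⟩⟩
      · exact Or.inr ⟨hab.symm, Or.inr ⟨ha, by rwa [if_pos hf.symm]⟩⟩
    · have hf' : ¬ IsFree V S p b a := fun h => hf h.symm
      by_cases c1 : CanDefeat V S a b
      · exact Or.inl ⟨hab, Or.inr ⟨hb, by rw [if_neg hf]; exact Or.inl c1⟩⟩
      by_cases c2 : CanDefeat V S b a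
      · exact Or.inr ⟨hab.symm, Or.inr ⟨ha, by rw [if_neg hf']; exact Or.inl c2⟩⟩
      rcases lt_or_gt_of_ne hab with h | h
      · exact Or.inl ⟨hab, Or.inr ⟨hb, by rw [if_neg hf]; exact Or.inr ⟨c2, h⟩⟩⟩
      · exact Or.inr ⟨hab.symm, Or.inr ⟨ha, by rw [if_neg hf']; exact Or.inr ⟨c1, h⟩⟩⟩
  let v : PairwiseVote m := ⟨fun a b => decide (P a b), fun a b hab => by
    simpa using hasymm a b (by simpa using hab)⟩
  have hU : ∀ a b, support (V ++ L.map fun n => (n, v)) a b =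
      support V a b + if P a b then S else 0 := by
    intro a b
    rw [support_append, support_map_same, hS]
    simp only [v, decide_eq_true_eq]
  refine ⟨L.map fun n => (n, v), by simp [Function.comp_def], ?_, ?_⟩
  · intro u hu
    obtain ⟨n, -, rfl⟩ := List.mem_map.1 hu
    cases tm
    · trivial
    · intro a b hab
      simpa [v] using htotal a b hab
  · have hscore : ∀ a, a ≠ p → (llullScore (V ++ L.map fun n => (n, v)) a : ℤ) ≤
        scoreBound V S p w := by
      intro a ha
      -- Every opponent against whom `a` scores is one that `a` won in the orientation or one that
      -- was forced; otherwise the common vote makes that opponent strictly defeat `a`.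
      refine h3 a (mem_erase.2 ⟨ha, mem_univ _⟩) _ fun b hb => ?_
      rw [mem_filter, hU, hU] at hb
      obtain ⟨-, hba, hle⟩ := hb
      by_cases hbp : b = p
      · right
        refine ⟨hba.symm, ha, ?_⟩
        have e1 : P b a := ⟨hba, Or.inl hbp⟩
        rw [if_pos e1, if_neg (hasymm _ _ e1)] at hle
        rw [CanDefeat]
        omega
      by_cases hf : IsFree V S p a b
      · left
        by_contra hw
        have e1 : P b a := ⟨hba, Or.inr ⟨ha, by
          rw [if_pos hf.symm]
          exact (h1 a b hf).resolve_left hw⟩⟩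
        rw [if_pos e1, if_neg (hasymm _ _ e1)] at hle
        have e2 := hf.2.2.2.2
        rw [CanDefeat] at e2
        omega
      · right
        refine ⟨hba.symm, ha, fun hcan => ?_⟩
        have e1 : P b a := ⟨hba, Or.inr ⟨ha, by
          rw [if_neg fun h => hf h.symm]
          exact Or.inl hcan⟩⟩
        rw [if_pos e1, if_neg (hasymm _ _ e1)] at hle
        rw [CanDefeat] at hcan
        omega
    have hbest : llullScore (V ++ L.map fun n => (n, v)) p = bestScore V S p := by
      rw [llullScore, bestScore]
      congr 1
      refine filter_congr fun b _ => and_congr_right fun hb => ?_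
      have e1 : P p b := ⟨hb.symm, Or.inl rfl⟩
      rw [hU, hU, if_pos e1, if_neg (hasymm _ _ e1), add_zero]
    rw [isLlullWinner_iff]
    intro a ha
    have := hscore a ha
    cases w <;> simp only [scoreBound, hbest] at this ⊢ <;> exact this

/-- The coalition can make `p` win if and only if balancing nearly succeeds. -/
theorem llullCWCM_iff {t : TieModel} (w : WinnerModel) (I : CWCMInstance t) (S : ℕ)
    (hS : (I.manipulators.map fun n : ℕ+ => (n : ℕ)).sum = S) :
    LlullCWCM t w I ↔ ∀ a ≠ I.preferred,
      (points (IsFree I.voters S I.preferred) (IsForced I.voters S I.preferred)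
        ((I.numCandidates + 4) ^ 6) a : ℤ) <
      ((I.numCandidates + 4) ^ 6 : ℕ) * (2 * scoreBound I.voters S I.preferred w) +
        ((I.numCandidates + 4) ^ 5 : ℕ) := by
  constructor
  · rintro ⟨W, h1, -, h2⟩ a ha
    refine points_lt_of_isLlullWinner I.voters W S I.preferred w ?_ h2 _ _ ?_ ha
    · rw [← hS, ← h1, List.map_map]
      rfl
    · have hn : 0 < I.numCandidates := I.preferred.pos
      generalize I.numCandidates = n at hn
      -- The summand `4` in `n + 4` absorbs the constant factor `4`: for `n > 0` it is strictly less
      -- than `n + 4`.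
      calc 4 * (n + 4) ^ 6 * n ^ 3 ≤ 4 * (n + 4) ^ 6 * (n + 4) ^ 3 :=
            Nat.mul_le_mul_left _ (Nat.pow_le_pow_left (by omega) 3)
        _ = 4 * (n + 4) ^ 9 := by ring
        _ < (n + 4) * (n + 4) ^ 9 := Nat.mul_lt_mul_of_pos_right (by omega) (by positivity)
        _ = ((n + 4) ^ 5) ^ 2 := by ring
  · intro h
    refine exists_isLlullWinner I.voters I.manipulators S I.preferred w t hS _ _ ?_ h
    rw [pow_succ (I.numCandidates + 4) 5, mul_comm]
    exact Nat.mul_le_mul_left _ (by omega)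

end Election

end

/-! ### The decision procedure: parsing, running time, correctness. -/

section

open Function Computability

set_option linter.unusedSimpArgs false

namespace Election

open StackProgram Balancing

/-! ### Reading the word of an instance -/

/-- The state of the parser: the bits since the last separator, the marks of the candidates, the
words since the last bracket, and the voters; all of them in reversed order. -/
abbrev ParserState : Type :=
  List Bool × List Bool × List (List Bool) × List (List (List Bool))

/-- One step of the parser. -/
def parseStep (s : ParserState) : Γ' → ParserState
  | .bit b => (b :: s.1, s.2)
  | .comma => if s.2.1 = [] then ([], s.1, s.2.2) else ([], s.2.1, s.1 :: s.2.2.1, s.2.2.2)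
  | .ket => (s.1, s.2.1, [], s.2.2.1 :: s.2.2.2)
  | .bra => s
  | .blank => s

/-- The parser. -/
def parse (l : List Γ') : ParserState := l.foldl parseStep ([], [], [], [])

theorem pTime_parse : PTime parse := by
  refine PTime.foldl (α := List Γ') (l := fun l => l) (c := fun _ => ([], [], [], []))
    (g := fun _ => parseStep) (by fun_prop) (.const _) ?_ 20 fun _ s x => ?_
  · refine PTime.symbol_cases
      (f := fun y (p : List Γ' × ParserState × Γ') => parseStep p.2.1 y) (by fun_prop) fun y => ?_
    cases y <;> simp only [parseStep] <;> fun_prop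
  · obtain ⟨c, m, f, v⟩ := s
    simp only [Polynomial.eval_ofNat]
    cases x with
    | bit b =>
      have := csize_bool_le b
      simp only [parseStep, csize_mk, csize_cons]
      omega
    | comma =>
      simp only [parseStep]
      split_ifs with h
      · simp only [h, csize_mk, csize_nil]
        omega
      · simp only [csize_mk, csize_cons, csize_nil]
        omega
    | ket =>
      simp only [parseStep, csize_mk, csize_cons, csize_nil]
      omega
    | bra => simp [parseStep]
    | blank => simp [parseStep]

theorem foldl_parseStep_encodeBits (l : List Bool) (s : ParserState) :
    (encodeBits l).foldl parseStep s = (l.reverse ++ s.1, s.2) := by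
  induction l generalizing s with
  | nil => rfl
  | cons b l ih =>
    simp only [encodeBits, List.map_cons, List.foldl_cons] at ih ⊢
    rw [ih]
    simp [parseStep]

/-- A word of bits that ends with a comma is put on the pile. -/
theorem foldl_parseStep_word (l : List Bool) {m : List Bool} (hm : m ≠ [])
    (f : List (List Bool)) (v : List (List (List Bool))) :
    (encodeBits l ++ [Γ'.comma]).foldl parseStep ([], m, f, v) = ([], m, l.reverse :: f, v) := by
  rw [List.foldl_append, foldl_parseStep_encodeBits]
  simp [parseStep, hm]

theorem foldl_parseStep_words {β : Type} (g : β → List Bool) (L : List β) {m : List Bool}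
    (hm : m ≠ []) (f : List (List Bool)) (v : List (List (List Bool))) :
    (L.flatMap fun x => encodeBits (g x) ++ [Γ'.comma]).foldl parseStep ([], m, f, v) =
      ([], m, (L.map fun x => (g x).reverse).reverse ++ f, v) := by
  induction L generalizing f with
  | nil => rfl
  | cons x L ih =>
    rw [List.flatMap_cons, List.foldl_append, foldl_parseStep_word _ hm, ih]
    simp

/-- The words of a voter. -/
def voterWords {m : ℕ} (v : ℕ+ × PairwiseVote m) : List (List Bool) :=
  (Nat.bits v.1).reverse ::
    (List.finRange m).map fun a => ((List.finRange m).map fun b => v.2.prefers a b).reverse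

theorem foldl_parseStep_encodeVoter {n : ℕ} (u : ℕ+ × PairwiseVote n) {m : List Bool}
    (hm : m ≠ []) (v : List (List (List Bool))) :
    (encodeVoter u).foldl parseStep ([], m, [], v) = ([], m, [], (voterWords u).reverse :: v) := by
  have h : encodeVoter u = Γ'.bra :: ((encodeBits (Nat.bits u.1) ++ [Γ'.comma]) ++
      (encodeVote u.2 ++ [Γ'.ket])) := by
    simp [encodeVoter, encodeWeight]
  rw [h, List.foldl_cons, List.foldl_append]
  simp only [parseStep]
  rw [foldl_parseStep_word _ hm, List.foldl_append, encodeVote, foldl_parseStep_words _ _ hm]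
  simp [parseStep, voterWords]

theorem foldl_parseStep_voters {n : ℕ} (V : Profile n) {m : List Bool}
    (hm : m ≠ []) (v : List (List (List Bool))) :
    (V.flatMap encodeVoter).foldl parseStep ([], m, [], v) =
      ([], m, [], (V.map fun u => (voterWords u).reverse).reverse ++ v) := by
  induction V generalizing v with
  | nil => rfl
  | cons u V ih =>
    rw [List.flatMap_cons, List.foldl_append, foldl_parseStep_encodeVoter _ hm, ih]
    simp

/-- There is at least one candidate, so the mark list is empty only before the first comma, and the
test in `parseStep` is unambiguous. The comma between voters and manipulators ends an empty word,
which stays as `[[]]` at the bottom of the pile and later counts as weight zero. -/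
theorem parse_encodeCWCM {t : TieModel} (I : CWCMInstance t) :
    parse (encodeCWCM I) =
      ([], ((List.finRange I.numCandidates).map fun a => decide (a = I.preferred)).reverse,
        (I.manipulators.map fun n : ℕ+ => (Nat.bits n).reverse).reverse ++ [[]],
        (I.voters.map fun u => (voterWords u).reverse).reverse) := by
  set M := (List.finRange I.numCandidates).map fun a => decide (a = I.preferred) with hM
  have hm : M.reverse ≠ [] := by
    have : 0 < I.numCandidates := I.preferred.pos
    rw [ne_eq, ← List.length_eq_zero_iff]
    simp [hM]
    omega
  have h : encodeCWCM I = encodeBits M ++ ([Γ'.comma] ++ (I.voters.flatMap encodeVoter ++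
      ((encodeBits [] ++ [Γ'.comma]) ++
        I.manipulators.flatMap fun n : ℕ+ => encodeBits (Nat.bits n) ++ [Γ'.comma]))) := by
    simp [encodeCWCM, encodeWeight, encodeBits, hM]
  rw [parse, h, List.foldl_append, foldl_parseStep_encodeBits, List.foldl_append]
  simp only [List.foldl_cons, List.foldl_nil, parseStep, if_true, List.append_nil]
  rw [List.foldl_append, foldl_parseStep_voters _ hm, List.foldl_append,
    foldl_parseStep_word _ hm, foldl_parseStep_words _ _ hm]
  simp

end Election

end

section

open Function Computability

set_option linter.unusedSimpArgs false

namespace Election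

open StackProgram Balancing

variable {α : Type} [Code α]

/-! ### The decision procedure -/

/-- The number of candidates, the preferred candidate, the weights and preference matrices of the
voters, and the total weight of the manipulators. -/
abbrev Table : Type := ℕ × ℕ × List (Bin × List (List Bool)) × Bin

/-- An entry of a preference matrix. -/
def matrixEntry (M : List (List Bool)) (i j : ℕ) : Bool := (M.getD i []).getD j false

/-- The total weight of the voters that prefer `i` to `j`. -/
def tableSupport (T : Table) (i j : ℕ) : Bin :=
  T.2.2.1.foldl (fun n v => n + if matrixEntry v.2 i j = true then v.1 else ⟨0⟩) ⟨0⟩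

/-- Whether the manipulators can make `i` defeat `j`. -/
def tableCanDefeat (T : Table) (i j : ℕ) : Bool :=
  decide ((tableSupport T j i).val < (tableSupport T i j + T.2.2.2).val)

/-- Whether the manipulators can choose the winner between `i` and `j`. -/
def tableFree (T : Table) (i j : ℕ) : Bool :=
  decide (i ≠ j ∧ i ≠ T.2.1 ∧ j ≠ T.2.1 ∧ tableCanDefeat T i j = true ∧
    tableCanDefeat T j i = true)

/-- Whether `i` gets a point against `j` in any case. -/
def tableForced (T : Table) (i j : ℕ) : Bool :=
  decide (i ≠ j ∧ i ≠ T.2.1 ∧ ¬ tableCanDefeat T j i = true)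

/-- The points that `i` receives for the pair `{i, j}`, given the list of the points so far. -/
def tableGain (T : Table) (y : List ℕ) (i j : ℕ) : ℕ :=
  if tableFree T i j = true then
    (if y.getD i 0 < y.getD j 0 then 2 else if y.getD i 0 = y.getD j 0 then 1 else 0)
  else if tableForced T i j = true then 2 else 0

/-- One round of balancing. -/
def tableRound (T : Table) (y : List ℕ) : List ℕ :=
  (List.range T.1).map fun i => y.getD i 0 + ((List.range T.1).map (tableGain T y i)).sum

/-- The number of rounds. -/
@[irreducible] def rounds (n : ℕ) : ℕ := (n + 4) ^ 6

/-- The number of points by which balancing may miss. -/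
@[irreducible] def slack (n : ℕ) : ℕ := (n + 4) ^ 5

/-- The points after all rounds. -/
def tablePoints (T : Table) : List ℕ :=
  (tableRound T)^[rounds T.1] ((List.range T.1).map fun _ => 0)

/-- The score of the preferred candidate if all manipulators vote for it. -/
def tableBest (T : Table) : ℕ :=
  ((List.range T.1).map fun j => if j ≠ T.2.1 ∧
    ¬ (tableSupport T T.2.1 j + T.2.2.2).val < (tableSupport T j T.2.1).val then 1 else 0).sum

/-- The test whether balancing nearly succeeds. -/
def tableTest (w : WinnerModel) (T : Table) : Bool :=
  (List.range T.1).all fun i => decide (i = T.2.1 ∨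
    -- In the unique-winner model the bound is one lower. The resulting `2 * rounds T.1` is added on
    -- the left, since subtraction would be truncated.
    (tablePoints T).getD i 0 + (match w with | .nonunique => 0 | .unique => 2 * rounds T.1) <
      rounds T.1 * (2 * tableBest T) + slack T.1)

section

variable {T : α → Table} {M : α → List (List Bool)} {y : α → List ℕ} {n i j : α → ℕ}

@[fun_prop] theorem pTime_matrixEntry (hM : PTime M) (hi : PTime i) (hj : PTime j) :
    PTime fun a => matrixEntry (M a) (i a) (j a) := by
  unfold matrixEntry
  fun_prop

@[fun_prop] theorem pTime_tableSupport (hT : PTime T) (hi : PTime i) (hj : PTime j) :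
    PTime fun a => tableSupport (T a) (i a) (j a) := by
  have h : PTime fun p : Table × ℕ × ℕ => tableSupport p.1 p.2.1 p.2.2 :=
    PTime.binSum (l := fun p : Table × ℕ × ℕ => p.1.2.2.1)
      (f := fun p v => if matrixEntry v.2 p.2.1 p.2.2 = true then v.1 else ⟨0⟩)
      (by fun_prop) (by fun_prop)
  exact h.comp (f := fun a => (T a, i a, j a)) (by fun_prop)

@[fun_prop] theorem pTime_tableCanDefeat (hT : PTime T) (hi : PTime i) (hj : PTime j) :
    PTime fun a => tableCanDefeat (T a) (i a) (j a) := by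
  unfold tableCanDefeat
  fun_prop

@[fun_prop] theorem pTime_tableFree (hT : PTime T) (hi : PTime i) (hj : PTime j) :
    PTime fun a => tableFree (T a) (i a) (j a) := by
  unfold tableFree
  fun_prop

@[fun_prop] theorem pTime_tableForced (hT : PTime T) (hi : PTime i) (hj : PTime j) :
    PTime fun a => tableForced (T a) (i a) (j a) := by
  unfold tableForced
  fun_prop

@[fun_prop] theorem pTime_tableGain (hT : PTime T) (hy : PTime y) (hi : PTime i) (hj : PTime j) :
    PTime fun a => tableGain (T a) (y a) (i a) (j a) := by
  unfold tableGain
  fun_prop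

@[fun_prop] theorem pTime_tableRound (hT : PTime T) (hy : PTime y) :
    PTime fun a => tableRound (T a) (y a) := by
  have h : PTime fun p : Table × List ℕ => tableRound p.1 p.2 := by
    unfold tableRound
    fun_prop
  exact h.comp (f := fun a => (T a, y a)) (by fun_prop)

theorem _root_.StackProgram.PTime.pow {f : α → ℕ} (hf : PTime f) (k : ℕ) :
    PTime fun a => f a ^ k := by
  induction k with
  | zero => simpa using PTime.const 1
  | succ k ih =>
    simp only [pow_succ]
    exact ih.mul hf

@[fun_prop] theorem pTime_rounds (hn : PTime n) : PTime fun a => rounds (n a) := by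
  unfold rounds
  exact PTime.pow (by fun_prop) 6

@[fun_prop] theorem pTime_slack (hn : PTime n) : PTime fun a => slack (n a) := by
  unfold slack
  exact PTime.pow (by fun_prop) 5

theorem tableGain_le (T : Table) (y : List ℕ) (i j : ℕ) : tableGain T y i j ≤ 2 := by
  unfold tableGain
  split_ifs <;> omega

theorem length_iterate_tableRound (T : Table) (k : ℕ) :
    ((tableRound T)^[k] ((List.range T.1).map fun _ => 0)).length = T.1 := by
  cases k with
  | zero => simp
  | succ k => rw [iterate_succ_apply', tableRound]; simp

/-- A round gives at most two points per opponent. The points therefore stay polynomial in the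
number of candidates, as their unary representation requires. -/
theorem le_of_mem_iterate_tableRound (T : Table) (k : ℕ) :
    ∀ x ∈ (tableRound T)^[k] ((List.range T.1).map fun _ => 0), x ≤ k * (2 * T.1) := by
  induction k with
  | zero => simp
  | succ k ih =>
    rw [iterate_succ_apply']
    intro x hx
    obtain ⟨i, hi, rfl⟩ := List.mem_map.1 hx
    rw [List.mem_range] at hi
    set y := (tableRound T)^[k] ((List.range T.1).map fun _ => 0) with hy
    have e1 : y.getD i 0 ≤ k * (2 * T.1) := by
      have hl : i < y.length := by rwa [hy, length_iterate_tableRound]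
      rw [List.getD_eq_getElem _ _ hl]
      exact ih _ (List.getElem_mem hl)
    have e2 : ((List.range T.1).map (tableGain T y i)).sum ≤ T.1 * 2 := by
      refine (List.sum_le_card_nsmul _ 2 ?_).trans (by simp)
      intro z hz
      obtain ⟨j, -, rfl⟩ := List.mem_map.1 hz
      exact tableGain_le T y i j
    rw [add_mul]
    omega

@[fun_prop] theorem pTime_tablePoints (hT : PTime T) : PTime fun a => tablePoints (T a) := by
  have h : PTime tablePoints := by
    refine PTime.iterate (f := fun T y => tableRound T y) (n := fun T : Table => rounds T.1)
      (by fun_prop) (by fun_prop) (by fun_prop)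
      ⟨.X * (2 * ((.X + 4) ^ 6 * (2 * .X)) + 1 + 1) + 1, fun T k hk => ?_⟩
    have hn : T.1 ≤ csize T := by
      obtain ⟨n, s⟩ := T
      rw [csize_mk, csize_nat]
      omega
    refine (csize_list_le (B := 2 * (rounds T.1 * (2 * T.1)) + 1) fun x hx => ?_).trans ?_
    · rw [csize_nat]
      have := (le_of_mem_iterate_tableRound T k x hx).trans (Nat.mul_le_mul_right _ hk)
      omega
    · rw [length_iterate_tableRound, rounds]
      simp only [Polynomial.eval_add, Polynomial.eval_mul, Polynomial.eval_pow, Polynomial.eval_X,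
        Polynomial.eval_ofNat, Polynomial.eval_one]
      gcongr
  exact h.comp hT

@[fun_prop] theorem pTime_tableBest (hT : PTime T) : PTime fun a => tableBest (T a) := by
  have h : PTime tableBest := by
    unfold tableBest
    fun_prop
  exact h.comp hT

@[fun_prop] theorem pTime_tableTest (w : WinnerModel) (hT : PTime T) :
    PTime fun a => tableTest w (T a) := by
  have h : PTime (tableTest w) := by
    unfold tableTest
    cases w <;> dsimp only <;> fun_prop
  exact h.comp hT

end

/-- The table of an instance that has been read. -/
def readTable (s : ParserState) : Table :=
  (s.2.1.length,
    -- Exactly one candidate of an encoded instance is marked, so the sum is its index.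
    ((List.range s.2.1.length).map fun i => if s.2.1.reverse.getD i false = true then i else 0).sum,
    s.2.2.2.map fun F => (Bin.ofBits (F.reverse.headD []), F.reverse.tail.map List.reverse),
    s.2.2.1.foldl (fun n l => n + Bin.ofBits l) ⟨0⟩)

theorem pTime_readTable : PTime readTable := by
  have h : PTime fun s : ParserState => s.2.2.1.foldl (fun n l => n + Bin.ofBits l) ⟨0⟩ :=
    PTime.binSum (l := fun s : ParserState => s.2.2.1) (f := fun _ l => Bin.ofBits l)
      (by fun_prop) (by fun_prop)
  unfold readTable
  fun_prop

end Election

end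

section

open Function Computability

set_option linter.unusedSimpArgs false

namespace Election

open StackProgram Balancing

/-! ### Correctness of the decision procedure -/

theorem sum_map_range_eq_sum_fin (n : ℕ) (f : ℕ → ℕ) :
    ((List.range n).map f).sum = ∑ i : Fin n, f i := by
  rw [← Finset.sum_range]
  rfl

theorem foldl_binAdd_val {β : Type} (f : β → Bin) (l : List β) (n : Bin) :
    (l.foldl (fun n b => n + f b) n).val = n.val + (l.map fun b => (f b).val).sum := by
  induction l generalizing n with
  | nil => simp
  | cons b l ih => rw [List.foldl_cons, ih]; simp [add_assoc]

/-- The table of an election. -/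
def electionTable {m : ℕ} (V : Profile m) (S : ℕ) (p : Fin m) : Table :=
  (m, p, (V.map fun v => ((⟨v.1⟩ : Bin), (List.finRange m).map fun a =>
    (List.finRange m).map fun b => v.2.prefers a b)).reverse, ⟨S⟩)

/-- The parser reverses words, which turns weights into the most-significant-first form of
`Bin.ofBits`; matrix rows are reversed back. The voters remain in reverse order, which is irrelevant
for sums of weights. -/
theorem readTable_parse {t : TieModel} (I : CWCMInstance t) :
    readTable (parse (encodeCWCM I)) = electionTable I.voters
      (I.manipulators.map fun n : ℕ+ => (n : ℕ)).sum I.preferred := by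
  rw [parse_encodeCWCM, readTable, electionTable]
  refine Prod.ext (by simp) (Prod.ext ?_ (Prod.ext ?_ (Bin.ext ?_)))
  · simp only [List.length_reverse, List.length_map, List.length_finRange, List.reverse_reverse]
    rw [sum_map_range_eq_sum_fin, Finset.sum_eq_single I.preferred]
    · simp
    · intro b _ hb
      simp [hb]
    · simp
  · simp only [List.map_reverse, List.map_map]
    congr 1
    refine List.map_congr_left fun v _ => ?_
    simp [voterWords, Bin.ofBits_reverse_bits, Function.comp_def]
  · have h : (Bin.ofBits []).val = 0 := rfl
    rw [foldl_binAdd_val]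
    simp only [List.map_append, List.map_reverse, List.sum_append, List.sum_reverse, List.map_map,
      Function.comp_def, Bin.ofBits_reverse_bits, List.map_cons, List.map_nil, List.sum_cons,
      List.sum_nil, h, add_zero, zero_add]

section

variable {m : ℕ} (V : Profile m) (S : ℕ) (p i j : Fin m)

theorem tableSupport_electionTable :
    (tableSupport (electionTable V S p) i j).val = support V i j := by
  rw [tableSupport, foldl_binAdd_val, electionTable, support]
  simp only [List.map_reverse, List.sum_reverse, List.map_map, zero_add]
  congr 1
  refine List.map_congr_left fun v _ => ?_
  have h : matrixEntry ((List.finRange m).map fun a => (List.finRange m).map fun b =>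
      v.2.prefers a b) i j = v.2.prefers i j := by
    simp [matrixEntry]
  simp only [Function.comp_apply, h]
  split_ifs <;> rfl

theorem tableCanDefeat_electionTable :
    tableCanDefeat (electionTable V S p) i j = true ↔ CanDefeat V S i j := by
  rw [tableCanDefeat, decide_eq_true_iff, Bin.val_add, tableSupport_electionTable,
    tableSupport_electionTable]
  rfl

theorem tableFree_electionTable :
    tableFree (electionTable V S p) i j = true ↔ IsFree V S p i j := by
  rw [tableFree, decide_eq_true_iff, tableCanDefeat_electionTable, tableCanDefeat_electionTable]
  simp [electionTable, IsFree, Fin.ext_iff]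

theorem tableForced_electionTable :
    tableForced (electionTable V S p) i j = true ↔ IsForced V S p i j := by
  rw [tableForced, decide_eq_true_iff, tableCanDefeat_electionTable]
  simp [electionTable, IsForced, Fin.ext_iff]

theorem tableRound_electionTable (y : Fin m → ℕ) :
    tableRound (electionTable V S p) (List.ofFn y) =
      List.ofFn fun i => y i + ∑ j, gain (IsFree V S p) (IsForced V S p) y i j := by
  refine List.ext_getElem (by simp [tableRound, electionTable]) fun i h1 h2 => ?_
  have hi : i < m := by simpa using h2
  have hg : ∀ j : Fin m, tableGain (electionTable V S p) (List.ofFn y) i j =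
      gain (IsFree V S p) (IsForced V S p) y ⟨i, hi⟩ j := by
    intro j
    have e1 := tableFree_electionTable V S p ⟨i, hi⟩ j
    have e2 := tableForced_electionTable V S p ⟨i, hi⟩ j
    simp only at e1 e2
    simp [tableGain, gain, e1, e2, hi]
  simp only [tableRound, List.getElem_map, List.getElem_range, List.getElem_ofFn]
  rw [sum_map_range_eq_sum_fin]
  congr 1
  · simp [hi]
  · exact Finset.sum_congr rfl fun j _ => hg j

theorem tablePoints_electionTable :
    tablePoints (electionTable V S p) =
      List.ofFn (points (IsFree V S p) (IsForced V S p) ((m + 4) ^ 6)) := by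
  have h : ∀ k, (tableRound (electionTable V S p))^[k] ((List.range m).map fun _ => 0) =
      List.ofFn (points (IsFree V S p) (IsForced V S p) k) := by
    intro k
    induction k with
    | zero =>
      refine List.ext_getElem (by simp) fun i h1 h2 => ?_
      simp [points]
    | succ k ih =>
      rw [iterate_succ_apply', ih, tableRound_electionTable]
      rfl
  rw [tablePoints, rounds]
  exact h _

theorem tableBest_electionTable : tableBest (electionTable V S p) = bestScore V S p := by
  rw [tableBest, bestScore, sum_map_range_eq_sum_fin, Finset.card_filter]
  refine Finset.sum_congr rfl fun (j : Fin m) _ => ?_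
  have e1 := tableSupport_electionTable V S p p j
  have e2 := tableSupport_electionTable V S p j p
  have h : (electionTable V S p).2.1 = p := rfl
  have h' : (electionTable V S p).2.2.2.val = S := rfl
  simp only [h, Bin.val_add, e1, e2, not_lt, h', ne_eq, Fin.ext_iff]

end

theorem tableTest_electionTable {m : ℕ} (V : Profile m) (S : ℕ) (p : Fin m) (w : WinnerModel) :
    tableTest w (electionTable V S p) = true ↔ ∀ a ≠ p,
      (points (IsFree V S p) (IsForced V S p) ((m + 4) ^ 6) a : ℤ) <
        ((m + 4) ^ 6 : ℕ) * (2 * scoreBound V S p w) + ((m + 4) ^ 5 : ℕ) := by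
  have e1 : (electionTable V S p).1 = m := rfl
  have e2 : (electionTable V S p).2.1 = p := rfl
  unfold tableTest
  rw [List.all_eq_true]
  simp only [e1, e2, List.mem_range, decide_eq_true_iff, tablePoints_electionTable,
    tableBest_electionTable, rounds, slack]
  generalize points (IsFree V S p) (IsForced V S p) ((m + 4) ^ 6) = y
  constructor
  · intro h a ha
    have h1 := (h a a.2).resolve_left (by simpa [Fin.ext_iff] using ha)
    simp only [List.getD_eq_getElem?_getD, List.getElem?_ofFn, a.2, dite_true,
      Option.getD_some, Fin.eta] at h1
    zify at h1
    cases w <;> simp only [scoreBound] at h1 ⊢ <;> push_cast at h1 ⊢ <;> linarith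
  · intro h i hi
    by_cases ha : i = p
    · exact Or.inl ha
    have h1 := h ⟨i, hi⟩ (by simpa [Fin.ext_iff] using ha)
    right
    simp only [List.getD_eq_getElem?_getD, List.getElem?_ofFn, hi, dite_true, Option.getD_some]
    zify
    cases w <;> simp only [scoreBound] at h1 ⊢ <;> push_cast at h1 ⊢ <;> linarith

end Election

end

theorem mainTheorem6 (t : Election.TieModel) (w : Election.WinnerModel) :
    InP (Election.encodeCWCM : Election.CWCMInstance t → List Computability.Γ')
      (Election.LlullCWCM t w) := by
  refine StackProgram.PTime.inP
    (f := fun l => Election.tableTest w (Election.readTable (Election.parse l)))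
    (Election.pTime_tableTest w (Election.pTime_readTable.comp Election.pTime_parse)) fun I => ?_
  rw [Election.readTable_parse, Election.tableTest_electionTable, Election.llullCWCM_iff w I _ rfl]
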